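/- Fix $T>0$. Let $\Omega=D([0,T];\mathbb R)$ be the space of real càdlàg paths with the Borel $\sigma$-algebra of the Skorokhod topology, $X$ the canonical process and $\mathbb F=(\mathcal F_t)_{t\in[0,T]}$ the raw filtration generated by $X$. For finite measures $\mu,\nu$ on $\mathbb R$ with finite first moment, write $\mu\le_c\nu$ if $\mu(\varphi)\le\nu(\varphi)$ for every convex $\varphi:\mathbb R\to\mathbb R$, and let $\mathcal M(\mu,\nu)$ be the set of finite measures $P$ on $\Omega$ under which $X$ is an $\mathbb F$-martingale with $P\circ X_0^{-1}=\mu$ and $P\circ X_T^{-1}=\nu$. Let $\mu\le_c\nu$ be an irreducible pair: with $u_\mu(x)=\int|x-y|\,\mu(dy)$, the set $I=\{u_\mu<u_\nu\}$ is connected and $\mu(I)=\mu(\mathbb R)$. Let $J$ be the union of $I$ and those endpoints of $I$ that are atoms of $\nu$. An averaging process is a nonnegative, $\mathbb F$-adapted, nondecreasing càdlàg process $A=(A_t)_{t\in[0,T]}$ with $A_T\equiv1$ (and $A_{0-}:=0$, so that $\int_{[0,T]}X_t\,dA_t$ includes the term $X_0A_0$). It is interior if $A_0\equiv0$ and $\Delta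 A_T\equiv0$, and strictly interior if, in addition, $A_t\equiv0$ for some $t\in(0,T)$. For a set $\mathcal A$ of averaging processes and a Borel function $f:\mathbb R\to[-\infty,\infty]$ put $$\widetilde{\mathbf S}_{\mu,\nu}(f)=\sup_{\mu\le_c\theta\le_c\nu}\theta(f),\qquad \mathbf S_{\mu,\nu}(f,\mathcal A)=\sup_{P\in\mathcal M(\mu,\nu)}\ \sup_{A\in\mathcal A}E^P\Big[f\Big(\int_{[0,T]}X_t\,dA_t\Big)\Big],$$ where an integral whose positive and negative parts are both infinite is read as $-\infty$. Suppose that one of the following holds: (i) $\mathcal A$ contains an interior averaging process, and $f$ is lower semicontinuous and satisfies $f\ge\varphi$ on $J$ for some $\nu$-integrable concave function $\varphi:J\to[-\infty,\infty]$; (ii) $\mathcal A$ contains a strictly interior averaging process, and $f$ is Borel. Then $\widetilde{\mathbf S}_{\mu,\nu}(f)\le\mathbf S_{\mu,\nu}(f,\mathcal A)$. -/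

import Mathlib

open MeasureTheory Set Filter Topology ProbabilityTheory
open scoped ENNReal NNReal

namespace RobustPricing

/-! ## Integrals of extended-real functions, convex order, irreducible pairs -/

/-- The integral `m(g) = m(g⁺) - m(g⁻)` of an extended-real function. If both parts are infinite,
the value is `-∞` (in `EReal`, `⊤ - ⊤ = ⊥`). -/
noncomputable def extIntegral {α : Type*} [MeasurableSpace α] (m : Measure α) (g : α → EReal) :
    EReal :=
  ((∫⁻ x, (g x).toENNReal ∂m : ℝ≥0∞) : EReal) - ((∫⁻ x, (-g x).toENNReal ∂m : ℝ≥0∞) : EReal)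

/-- A finite measure on the real line with finite first moment. -/
structure FiniteFirstMoment (μ : Measure ℝ) : Prop where
  finite : IsFiniteMeasure μ
  moment : Integrable (fun x : ℝ => x) μ

/-- The convex order `μ ≤_c ν`; both measures are required to be finite with finite first moment.
The integral of a real convex function against such a measure is well defined in `(-∞, ∞]`. -/
structure ConvexOrder (μ ν : Measure ℝ) : Prop where
  left : FiniteFirstMoment μ
  right : FiniteFirstMoment ν
  le : ∀ φ : ℝ → ℝ, ConvexOn ℝ univ φ →
    extIntegral μ (fun x => (φ x : EReal)) ≤ extIntegral ν (fun x => (φ x : EReal))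

/-- The potential function `u_μ(x) = ∫ |x - y| μ(dy)`. -/
noncomputable def potential (μ : Measure ℝ) (x : ℝ) : ℝ≥0∞ :=
  ∫⁻ y, ENNReal.ofReal |x - y| ∂μ

/-- The set `I = {u_μ < u_ν}`. -/
def domainI (μ ν : Measure ℝ) : Set ℝ := {x | potential μ x < potential ν x}

/-- The union `J` of `I` and the endpoints of `I` that are atoms of `ν`. -/
def domainJ (μ ν : Measure ℝ) : Set ℝ :=
  domainI μ ν ∪ {b | (IsGLB (domainI μ ν) b ∨ IsLUB (domainI μ ν) b) ∧ ν {b} ≠ 0}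

/-- The pair `μ ≤_c ν` is irreducible: `I` is connected (possibly empty) and carries `μ`. -/
structure IsIrreduciblePair (μ ν : Measure ℝ) : Prop where
  convexOrder : ConvexOrder μ ν
  connected : IsPreconnected (domainI μ ν)
  full : μ (domainI μ ν) = μ univ

/-- Concavity on `J` of an extended-real function (values `±∞` allowed): its hypograph over `J`
is convex. -/
def ConcaveOnExt (J : Set ℝ) (φ : ℝ → EReal) : Prop :=
  Convex ℝ {p : ℝ × ℝ | p.1 ∈ J ∧ (p.2 : EReal) ≤ φ p.1}

/-- Integrability over `J` of an extended-real function. -/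
def IntegrableOnExt (J : Set ℝ) (φ : ℝ → EReal) (ν : Measure ℝ) : Prop :=
  AEMeasurable φ (ν.restrict J) ∧ ∫⁻ x in J, (φ x).abs ∂ν < ⊤

/-- `f` is bounded from below, on `J`, by a `ν`-integrable concave function `φ : J → [-∞, ∞]`
(only the values of `φ` on `J` matter). -/
def BoundedBelowByConcave (μ ν : Measure ℝ) (f : ℝ → EReal) : Prop :=
  ∃ φ : ℝ → EReal, ConcaveOnExt (domainJ μ ν) φ ∧ IntegrableOnExt (domainJ μ ν) φ ν ∧
    ∀ x ∈ domainJ μ ν, φ x ≤ f x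

/-- The auxiliary primal value `sup {θ(f) : μ ≤_c θ ≤_c ν}`. -/
noncomputable def auxPrimalValue (μ ν : Measure ℝ) (f : ℝ → EReal) : EReal :=
  ⨆ (θ : Measure ℝ) (_ : ConvexOrder μ θ) (_ : ConvexOrder θ ν), extIntegral θ f

/-! ## The Skorokhod space -/

/-- A real-valued càdlàg function on `[0, T]`. -/
structure CadlagPath (T : ℝ) where
  toFun : Icc (0 : ℝ) T → ℝ
  right_cont : ∀ t, ContinuousWithinAt toFun (Ici t) t
  left_lim : ∀ t, ∃ l : ℝ, Tendsto toFun (𝓝[<] t) (𝓝 l)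

/-- The Skorokhod distance: the infimum, over increasing bijections `l` of `[0, T]`, of
`max (sup_t |l t - t|) (sup_t |x t - y (l t)|)`. -/
noncomputable def skorokhodDist {T : ℝ} (x y : CadlagPath T) : ℝ≥0∞ :=
  ⨅ l : Icc (0 : ℝ) T ≃o Icc (0 : ℝ) T,
    max (⨆ t, edist (l t) t) (⨆ t, edist (x.toFun t) (y.toFun (l t)))

theorem skorokhodDist_self {T : ℝ} (x : CadlagPath T) : skorokhodDist x x = 0 := by
  refine nonpos_iff_eq_zero.1 ((iInf_le _ (OrderIso.refl _)).trans ?_)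
  simp

theorem skorokhodDist_comm_le {T : ℝ} (x y : CadlagPath T) :
    skorokhodDist x y ≤ skorokhodDist y x := by
  refine le_iInf fun l => (iInf_le _ l.symm).trans (max_le_max ?_ ?_)
  · refine iSup_le fun t => le_trans ?_ (le_iSup _ (l.symm t))
    rw [OrderIso.apply_symm_apply, edist_comm]
  · refine iSup_le fun t => le_trans ?_ (le_iSup _ (l.symm t))
    rw [OrderIso.apply_symm_apply, edist_comm]

theorem skorokhodDist_triangle {T : ℝ} (x y z : CadlagPath T) :
    skorokhodDist x z ≤ skorokhodDist x y + skorokhodDist y z := by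
  unfold skorokhodDist
  rw [ENNReal.iInf_add]
  refine le_iInf fun l => ?_
  rw [ENNReal.add_iInf]
  refine le_iInf fun k => (iInf_le _ (l.trans k)).trans (max_le ?_ ?_)
  · refine iSup_le fun t => ?_
    calc edist ((l.trans k) t) t ≤ edist (l t) t + edist (k (l t)) (l t) := by
          rw [OrderIso.trans_apply, add_comm]; exact edist_triangle _ _ _
      _ ≤ _ := add_le_add ((le_iSup (fun t => edist (l t) t) t).trans (le_max_left _ _))
          ((le_iSup (fun t => edist (k t) t) (l t)).trans (le_max_left _ _))
  · refine iSup_le fun t => ?_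
    calc edist (x.toFun t) (z.toFun ((l.trans k) t))
        ≤ edist (x.toFun t) (y.toFun (l t)) + edist (y.toFun (l t)) (z.toFun (k (l t))) := by
          rw [OrderIso.trans_apply]; exact edist_triangle _ _ _
      _ ≤ _ := add_le_add
          ((le_iSup (fun t => edist (x.toFun t) (y.toFun (l t))) t).trans (le_max_right _ _))
          ((le_iSup (fun t => edist (y.toFun t) (z.toFun (k t))) (l t)).trans (le_max_right _ _))

/-- The Skorokhod metric; it induces the Skorokhod (J1) topology. -/
noncomputable instance instSkorokhod (T : ℝ) : PseudoEMetricSpace (CadlagPath T) where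
  edist := skorokhodDist
  edist_self := skorokhodDist_self
  edist_comm x y := le_antisymm (skorokhodDist_comm_le x y) (skorokhodDist_comm_le y x)
  edist_triangle := skorokhodDist_triangle

/-- The Borel σ-algebra of the Skorokhod topology. -/
noncomputable instance instMeasurableSpace (T : ℝ) : MeasurableSpace (CadlagPath T) := borel _

instance instBorelSpace (T : ℝ) : BorelSpace (CadlagPath T) := ⟨rfl⟩

/-- The canonical process. -/
def X {T : ℝ} (t : Icc (0 : ℝ) T) (ω : CadlagPath T) : ℝ := ω.toFun t

theorem exists_of_edist_lt {T : ℝ} {x y : CadlagPath T} {ε : ℝ} (h : edist x y < ENNReal.ofReal ε) :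
    ∃ l : Icc (0 : ℝ) T ≃o Icc (0 : ℝ) T,
      (∀ t, |(l t : ℝ) - t| < ε) ∧ ∀ t, |x.toFun t - y.toFun (l t)| < ε := by
  obtain ⟨l, hl⟩ := iInf_lt_iff.1 (show skorokhodDist x y < _ from h)
  have hε : 0 < ε := ENNReal.ofReal_pos.1 (lt_of_le_of_lt (zero_le) hl)
  refine ⟨l, fun t => ?_, fun t => ?_⟩
  · have := lt_of_le_of_lt
      ((le_iSup (fun t => edist (l t) t) t).trans (le_max_left _ _)) hl
    rw [edist_dist, ENNReal.ofReal_lt_ofReal_iff hε] at this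
    rwa [Subtype.dist_eq, Real.dist_eq] at this
  · have := lt_of_le_of_lt
      ((le_iSup (fun t => edist (x.toFun t) (y.toFun (l t))) t).trans (le_max_right _ _)) hl
    rwa [edist_dist, ENNReal.ofReal_lt_ofReal_iff hε, Real.dist_eq] at this

theorem isOpen_exists_gt {T : ℝ} (a b c : ℝ) :
    IsOpen {ω : CadlagPath T | ∃ s : Icc (0 : ℝ) T, (s : ℝ) ∈ Ioo a b ∧ c < ω.toFun s} := by
  rw [EMetric.isOpen_iff]
  rintro ω ⟨s, hs, hc⟩
  set ε := min (min (s - a) (b - s)) (ω.toFun s - c) with hε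
  have h1 : ε ≤ s - a := (min_le_left _ _).trans (min_le_left _ _)
  have h2 : ε ≤ b - s := (min_le_left _ _).trans (min_le_right _ _)
  have h3 : ε ≤ ω.toFun s - c := min_le_right _ _
  have hpos : 0 < ε := lt_min (lt_min (sub_pos.2 hs.1) (sub_pos.2 hs.2)) (sub_pos.2 hc)
  refine ⟨ENNReal.ofReal ε, ENNReal.ofReal_pos.2 hpos, fun y hy => ?_⟩
  rw [Metric.mem_eball, edist_comm] at hy
  obtain ⟨l, hl1, hl2⟩ := exists_of_edist_lt hy
  have e1 := abs_lt.1 (hl1 s)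
  have e2 := abs_lt.1 (hl2 s)
  exact ⟨l s, ⟨by linarith [e1.1], by linarith [e1.2]⟩, by linarith [e2.2]⟩

theorem isOpen_end_gt {T : ℝ} (t : Icc (0 : ℝ) T) (ht : (t : ℝ) = T) (c : ℝ) :
    IsOpen {ω : CadlagPath T | c < ω.toFun t} := by
  rw [EMetric.isOpen_iff]
  intro ω hc
  have hc' : c < ω.toFun t := hc
  refine ⟨ENNReal.ofReal (ω.toFun t - c), ENNReal.ofReal_pos.2 (sub_pos.2 hc'), fun y hy => ?_⟩
  rw [Metric.mem_eball, edist_comm] at hy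
  obtain ⟨l, -, hl2⟩ := exists_of_edist_lt hy
  have hlt : l t = t := by
    have htop : ∀ s : Icc (0 : ℝ) T, s ≤ t := fun s => by
      rw [← Subtype.coe_le_coe, ht]; exact s.2.2
    refine le_antisymm (htop _) ?_
    rw [← l.symm_apply_le]
    exact htop _
  have e2 := abs_lt.1 (hl2 t)
  rw [hlt] at e2
  show c < y.toFun t
  linarith [e2.2]

/-- The coordinate maps are Borel measurable for the Skorokhod topology. -/
theorem measurable_X {T : ℝ} (t : Icc (0 : ℝ) T) : Measurable (X t) := by
  refine measurable_of_Ioi fun c => ?_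
  rcases eq_or_lt_of_le t.2.2 with ht | ht
  · exact (isOpen_end_gt t ht c).measurableSet
  have key : X t ⁻¹' Ioi c = ⋃ q : {q : ℚ // c < q}, ⋂ n : ℕ,
      {ω : CadlagPath T | ∃ s : Icc (0 : ℝ) T, (s : ℝ) ∈ Ioo (t : ℝ) (t + 1 / ((n : ℝ) + 1)) ∧
        ((q : ℚ) : ℝ) < ω.toFun s} := by
    ext ω
    simp only [mem_preimage, mem_Ioi, mem_iUnion, mem_iInter, mem_ofPred_eq, X]
    constructor
    · intro h
      obtain ⟨q, hq1, hq2⟩ := exists_rat_btwn h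
      refine ⟨⟨q, hq1⟩, fun n => ?_⟩
      have hev := (ω.right_cont t).eventually (lt_mem_nhds hq2)
      obtain ⟨ε, hε, hball⟩ := Metric.mem_nhdsWithin_iff.1 hev
      have hn : (0 : ℝ) < 1 / ((n : ℝ) + 1) := by positivity
      set d := min (min ε (1 / ((n : ℝ) + 1))) (T - t) with hd
      have hdpos : 0 < d := lt_min (lt_min hε hn) (sub_pos.2 ht)
      have d1 : d ≤ ε := (min_le_left _ _).trans (min_le_left _ _)
      have d2 : d ≤ 1 / ((n : ℝ) + 1) := (min_le_left _ _).trans (min_le_right _ _)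
      have d3 : d ≤ T - t := min_le_right _ _
      have h0 := t.2.1
      refine ⟨⟨t + d / 2, by linarith, by linarith⟩, ⟨by simp; linarith, by simp only; linarith⟩, ?_⟩
      refine hball ⟨?_, ?_⟩
      · rw [Metric.mem_ball, Subtype.dist_eq, Real.dist_eq]
        rw [abs_lt]; constructor <;> simp only <;> linarith
      · rw [mem_Ici, ← Subtype.coe_le_coe]; simp only; linarith
    · rintro ⟨⟨q, hq⟩, h⟩
      refine lt_of_lt_of_le hq ?_
      by_contra hlt
      push Not at hlt
      have hev := (ω.right_cont t).eventually (gt_mem_nhds hlt)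
      obtain ⟨ε, hε, hball⟩ := Metric.mem_nhdsWithin_iff.1 hev
      obtain ⟨n, hn⟩ := exists_nat_one_div_lt hε
      obtain ⟨s, hs, hqs⟩ := h n
      have hs' : s ∈ Metric.ball t ε ∩ Ici t := by
        refine ⟨?_, ?_⟩
        · rw [Metric.mem_ball, Subtype.dist_eq, Real.dist_eq, abs_lt]
          constructor <;> linarith [hs.1, hs.2]
        · rw [mem_Ici, ← Subtype.coe_le_coe]
          exact hs.1.le
      have hlt' : ω.toFun s < q := hball hs'
      exact absurd hqs (not_lt.2 hlt'.le)
  rw [key]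
  exact MeasurableSet.iUnion fun q => MeasurableSet.iInter fun n =>
    (isOpen_exists_gt _ _ _).measurableSet

/-- The raw filtration generated by the canonical process. -/
noncomputable def canonicalFiltration (T : ℝ) :
    Filtration (Icc (0 : ℝ) T) (instMeasurableSpace T) :=
  Filtration.natural X fun t => (measurable_X t).stronglyMeasurable

/-! ## Martingale couplings, averaging processes, robust price -/

/-- The time `0` in `[0, T]`. -/
def time0 (T : ℝ) [hT : Fact (0 < T)] : Icc (0 : ℝ) T := ⟨0, le_rfl, hT.out.le⟩

/-- The time `T` in `[0, T]`. -/
def timeT (T : ℝ) [hT : Fact (0 < T)] : Icc (0 : ℝ) T := ⟨T, hT.out.le, le_rfl⟩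

/-- `P` is a continuous-time martingale coupling of `μ` and `ν`: a finite measure on the Skorokhod
space under which `X` is a martingale with marginals `μ` at time `0` and `ν` at time `T`. -/
structure IsMartingaleCoupling {T : ℝ} [Fact (0 < T)] (μ ν : Measure ℝ)
    (P : Measure (CadlagPath T)) : Prop where
  finite : IsFiniteMeasure P
  map_zero : P.map (X (time0 T)) = μ
  map_end : P.map (X (timeT T)) = ν
  martingale : Martingale X (canonicalFiltration T) P

/-- An averaging process: nonnegative, adapted, nondecreasing, càdlàg, with `A_T = 1`
(left limits exist by monotonicity). -/
structure AveragingProcess (T : ℝ) [Fact (0 < T)] where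
  toFun : Icc (0 : ℝ) T → CadlagPath T → ℝ
  nonneg : ∀ t ω, 0 ≤ toFun t ω
  adapted : Adapted (canonicalFiltration T) toFun
  mono : ∀ ω, Monotone fun t => toFun t ω
  right_cont : ∀ ω t, ContinuousWithinAt (fun s => toFun s ω) (Ici t) t
  end_eq : ∀ ω, toFun (timeT T) ω = 1

namespace AveragingProcess

variable {T : ℝ} [hT : Fact (0 < T)]

/-- `A` is interior: `A_0 = 0` and `A` does not jump at time `T`. -/
def IsInterior (A : AveragingProcess T) : Prop :=
  (∀ ω, A.toFun (time0 T) ω = 0) ∧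
    ∀ ω, Tendsto (fun t => A.toFun t ω) (𝓝[<] timeT T) (𝓝 (A.toFun (timeT T) ω))

/-- `A` is strictly interior: it is interior and vanishes identically at some `t ∈ (0, T)`. -/
def IsStrictlyInterior (A : AveragingProcess T) : Prop :=
  A.IsInterior ∧ ∃ t : Icc (0 : ℝ) T, (t : ℝ) ∈ Ioo 0 T ∧ ∀ ω, A.toFun t ω = 0

/-- The path `t ↦ A_t(ω)`, extended by `0` on `(-∞, 0)` (so `A_{0-} = 0`) and by `A_T(ω) = 1` on
`(T, ∞)`, as a Stieltjes function. -/
noncomputable def stieltjes (A : AveragingProcess T) (ω : CadlagPath T) : StieltjesFunction ℝ where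
  toFun s := if s < 0 then 0 else A.toFun (projIcc 0 T hT.out.le s) ω
  mono' := by
    intro s t hst
    dsimp only
    split_ifs with h1 h2 h2
    · exact le_rfl
    · exact A.nonneg _ _
    · exact absurd (hst.trans_lt h2) h1
    · exact A.mono ω (monotone_projIcc _ hst)
  right_continuous' := by
    intro s
    rcases lt_or_ge s 0 with h | h
    · refine ContinuousAt.continuousWithinAt ?_
      refine (continuousAt_const (y := (0 : ℝ))).congr ?_
      filter_upwards [gt_mem_nhds h] with u hu
      rw [if_pos hu]
    · have h1 : ContinuousWithinAt (fun u => A.toFun (projIcc 0 T hT.out.le u) ω) (Ici s) s :=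
        (A.right_cont ω (projIcc 0 T hT.out.le s)).comp
          continuous_projIcc.continuousWithinAt fun u hu => mem_Ici.2 (monotone_projIcc _ (mem_Ici.1 hu))
      refine h1.congr (fun u hu => ?_) ?_
      · exact if_neg (not_lt.2 (h.trans hu))
      · exact if_neg (not_lt.2 h)

/-- The average `∫_{[0,T]} X_t dA_t`: the pathwise Lebesgue-Stieltjes integral over the closed
interval `[0, T]`, including the atom `A_0` at time `0`. -/
noncomputable def average (A : AveragingProcess T) (ω : CadlagPath T) : ℝ :=
  ∫ s in Icc 0 T, X (projIcc 0 T hT.out.le s) ω ∂(A.stieltjes ω).measure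

end AveragingProcess

/-- The robust model-based price: the supremum of `E^P[f(∫ X dA)]` over all martingale couplings
`P` of `μ` and `ν` and all `A ∈ 𝒜`. -/
noncomputable def robustPrice {T : ℝ} [Fact (0 < T)] (μ ν : Measure ℝ) (f : ℝ → EReal)
    (𝒜 : Set (AveragingProcess T)) : EReal :=
  ⨆ (P : Measure (CadlagPath T)) (_ : IsMartingaleCoupling μ ν P) (A ∈ 𝒜),
    extIntegral P fun ω => f (A.average ω)

end RobustPricing

namespace RobustPricing

/-! Fix `θ` with `μ ≤_c θ ≤_c ν`. Strassen's theorem, applied twice, gives a three-step martingale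
`(x, y, z)` with marginals `μ`, `θ`, `ν` (`exists_threeStepLaw`). For `t ∈ (0, T)` let the path be
`x` on `[0, t)`, `y` on `[t, T)` and `z` at `T`; its law is a martingale coupling of `μ` and `ν`. An
interior `A` has no jump at `T`, so `z` drops out and the average equals `A_{t-} x + (1 - A_{t-})
y`.

If `A` is strictly interior, choose `t` with `A_t ≡ 0`: the average is exactly `y`, whose law is
`θ`, and no regularity of `f` beyond measurability is needed. Otherwise let `t` decrease to `0`.
Since `A` is adapted and the path is constant before `t`, `A_{t-}` is controlled by `A` along one
fixed path, and tends to `A_0 = 0`. The averages therefore converge to `y`, and lower semicontinuity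
with Fatou's lemma gives the bound.

Fatou needs an integrable majorant of the negative parts. Let `ψ` be `φ⁻` on `J` and `∞` elsewhere;
it is convex. Hence `ψ` at the average is at most `ψ(x) + ψ(y)`, and Jensen gives `μ(ψ) ≤ θ(ψ) ≤
ν(ψ)`. The last integral is finite because irreducibility forces `ν` to live on `J`.

Strassen's theorem is proved by duality: a positive functional is extended from functions `f(x) +
g(y) + k(x)(y - x)` to all functions of linear growth, represented by a measure, and disintegrated.
-/

/-! ### Extended integrals and the convex order. -/

theorem exists_subgradient {s : Set ℝ} {φ : ℝ → ℝ} (h : ConvexOn ℝ s φ) {y : ℝ}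
    (hy : y ∈ interior s) : ∃ a, ∀ x ∈ s, φ y + a * (x - y) ≤ φ x := by
  refine ⟨derivWithin φ (Ioi y) y, fun x hx => ?_⟩
  rcases lt_trichotomy x y with hxy | rfl | hxy
  · have h1 := (h.slope_le_leftDeriv_of_mem_interior hx hy hxy).trans
      (h.leftDeriv_le_rightDeriv_of_mem_interior hy)
    rw [slope_def_field, div_le_iff₀ (sub_pos.2 hxy)] at h1
    linarith
  · simp
  · have h1 := h.rightDeriv_le_slope_of_mem_interior hy hx hxy
    rw [slope_def_field, le_div_iff₀ (sub_pos.2 hxy)] at h1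
    linarith

theorem extIntegral_coe {α : Type*} [MeasurableSpace α] (m : Measure α) (g : α → ℝ) :
    extIntegral m (fun x => (g x : EReal)) =
      ((∫⁻ x, ENNReal.ofReal (g x) ∂m : ℝ≥0∞) : EReal) -
        ((∫⁻ x, ENNReal.ofReal (-g x) ∂m : ℝ≥0∞) : EReal) := by
  simp only [extIntegral, EReal.real_coe_toENNReal, ← EReal.coe_neg]

theorem extIntegral_coe_of_integrable {α : Type*} [MeasurableSpace α] {m : Measure α} {g : α → ℝ}
    (hg : Integrable g m) : extIntegral m (fun x => (g x : EReal)) = ((∫ x, g x ∂m : ℝ) : EReal) := by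
  have h1 : ∫⁻ x, ENNReal.ofReal (g x) ∂m ≠ ⊤ := hg.lintegral_lt_top.ne
  have h2 : ∫⁻ x, ENNReal.ofReal (-g x) ∂m ≠ ⊤ := hg.neg.lintegral_lt_top.ne
  rw [extIntegral_coe, integral_eq_lintegral_pos_part_sub_lintegral_neg_part hg, EReal.coe_sub,
    EReal.coe_ennreal_toReal h1, EReal.coe_ennreal_toReal h2]

theorem integrable_of_lintegral_ofReal {α : Type*} [MeasurableSpace α] {m : Measure α} {g : α → ℝ}
    (hg : AEStronglyMeasurable g m) (h1 : ∫⁻ x, ENNReal.ofReal (g x) ∂m ≠ ⊤)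
    (h2 : ∫⁻ x, ENNReal.ofReal (-g x) ∂m ≠ ⊤) : Integrable g m := by
  refine ⟨hg, ?_⟩
  have h3 : ∀ x, ‖g x‖ₑ ≤ ENNReal.ofReal (g x) + ENNReal.ofReal (-g x) := fun x => by
    rw [Real.enorm_eq_ofReal_abs]
    rcases le_total 0 (g x) with h | h
    · rw [abs_of_nonneg h]; exact le_self_add
    · rw [abs_of_nonpos h]; exact le_add_self
  refine (lintegral_mono h3).trans_lt ?_
  rw [lintegral_add_left' hg.aemeasurable.ennreal_ofReal]
  exact ENNReal.add_lt_top.2 ⟨h1.lt_top, h2.lt_top⟩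

theorem FiniteFirstMoment.integrable_affine {μ : Measure ℝ} (hμ : FiniteFirstMoment μ) (a b : ℝ) :
    Integrable (fun x => a * x + b) μ := by
  have := hμ.finite
  exact (hμ.moment.const_mul a).add (integrable_const b)

/-- A supporting line bounds the negative part of `φ` under `μ`. An infinite positive part would
then make the left side of the convex order inequality `⊤`, while the right side is real. -/
theorem ConvexOrder.integrable_and_integral_le {μ ν : Measure ℝ} (h : ConvexOrder μ ν) {φ : ℝ → ℝ}
    (hφ : ConvexOn ℝ univ φ) (hν : Integrable φ ν) :
    Integrable φ μ ∧ ∫ x, φ x ∂μ ≤ ∫ x, φ x ∂ν := by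
  have hle := h.le φ hφ
  rw [extIntegral_coe_of_integrable hν] at hle
  have hc : Continuous φ := hφ.locallyLipschitz.continuous
  obtain ⟨a, ha⟩ := exists_subgradient hφ (y := 0) (by simp)
  have hneg : ∫⁻ x, ENNReal.ofReal (-φ x) ∂μ ≠ ⊤ := by
    refine ((lintegral_mono fun x => ENNReal.ofReal_le_ofReal ?_).trans_lt
      (h.left.integrable_affine (-a) (-φ 0)).lintegral_lt_top).ne
    have := ha x trivial
    linarith
  have hpos : ∫⁻ x, ENNReal.ofReal (φ x) ∂μ ≠ ⊤ := by
    intro htop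
    rw [extIntegral_coe, htop] at hle
    lift ∫⁻ x, ENNReal.ofReal (-φ x) ∂μ to ℝ≥0 using hneg with r
    exact absurd hle (not_le.2 (EReal.coe_lt_top _))
  have hμ := integrable_of_lintegral_ofReal hc.aestronglyMeasurable hpos hneg
  rw [extIntegral_coe_of_integrable hμ] at hle
  exact ⟨hμ, EReal.coe_le_coe_iff.1 hle⟩

theorem ConvexOrder.integral_affine {μ ν : Measure ℝ} (h : ConvexOrder μ ν) (a b : ℝ) :
    ∫ x, (a * x + b) ∂μ = ∫ x, (a * x + b) ∂ν := by
  have hc : ∀ a b : ℝ, ConvexOn ℝ univ fun x => a * x + b := fun a b =>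
    ⟨convex_univ, fun x _ y _ s t _ _ hst => by
      simp only [smul_eq_mul]
      exact le_of_eq (by linear_combination (-b) * hst)⟩
  refine le_antisymm (h.integrable_and_integral_le (hc a b) (h.right.integrable_affine a b)).2 ?_
  have h2 := (h.integrable_and_integral_le (hc (-a) (-b)) (h.right.integrable_affine (-a) (-b))).2
  have e : (fun x : ℝ => -a * x + -b) = fun x => -(a * x + b) := by ext x; ring
  rw [e, integral_neg, integral_neg] at h2
  linarith

theorem ConvexOrder.measure_univ_eq {μ ν : Measure ℝ} (h : ConvexOrder μ ν) : μ univ = ν univ := by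
  have := h.left.finite
  have := h.right.finite
  have h1 := h.integral_affine 0 1
  simp only [zero_mul, zero_add, integral_const, smul_eq_mul, mul_one] at h1
  exact (measureReal_eq_measureReal_iff).1 h1

/-! ### Duality: a positive functional carrying the martingale constraints. -/

/-- Weak duality for martingale couplings. -/
theorem ConvexOrder.integral_add_integral_nonneg {μ ν : Measure ℝ} (h : ConvexOrder μ ν)
    {f g k : ℝ → ℝ} (hf : Integrable f μ) (hg : Integrable g ν)
    (hpos : ∀ x y, 0 ≤ f x + g y + k x * (y - x)) : 0 ≤ ∫ x, f x ∂μ + ∫ y, g y ∂ν := by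
  -- A supremum of affine functions of `y`, hence convex, and squeezed as `-f ≤ φ ≤ g`. Thus `μ(-f)
  -- ≤ μ(φ) ≤ ν(φ) ≤ ν(g)`.
  set φ : ℝ → ℝ := fun y => ⨆ x, (-f x - k x * (y - x)) with hφ
  have hbdd : ∀ y, BddAbove (range fun x => -f x - k x * (y - x)) := fun y =>
    ⟨g y, by rintro _ ⟨x, rfl⟩; have := hpos x y; simp only; linarith⟩
  have hle : ∀ x y, -f x - k x * (y - x) ≤ φ y := fun x y => le_ciSup (hbdd y) x
  have hφg : ∀ y, φ y ≤ g y := fun y => ciSup_le fun x => by have := hpos x y; linarith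
  have hfφ : ∀ x, -f x ≤ φ x := fun x => by simpa using hle x x
  have hconv : ConvexOn ℝ univ φ := by
    refine ⟨convex_univ, fun x _ y _ s t hs ht hst => ciSup_le fun z => ?_⟩
    simp only [smul_eq_mul]
    have h1 := mul_le_mul_of_nonneg_left (hle z x) hs
    have h2 := mul_le_mul_of_nonneg_left (hle z y) ht
    refine le_trans (le_of_eq ?_) (add_le_add h1 h2)
    linear_combination (f z - k z * z) * (hst)
  have hc : Continuous φ := hconv.locallyLipschitz.continuous
  have hν : Integrable φ ν := by
    obtain ⟨a, ha⟩ := exists_subgradient hconv (y := 0) (by simp)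
    refine integrable_of_le_of_le hc.aestronglyMeasurable (ae_of_all _ fun y => ?_)
      (ae_of_all _ hφg) (h.right.integrable_affine a (φ 0)) hg
    have := ha y trivial
    linarith
  obtain ⟨hμ, hle2⟩ := h.integrable_and_integral_le hconv hν
  have h1 : ∫ x, -f x ∂μ ≤ ∫ x, φ x ∂μ := integral_mono hf.neg hμ hfφ
  have h2 := integral_mono hν hg hφg
  rw [integral_neg] at h1
  linarith

/-- Functions on the plane of at most linear growth. -/
def linearGrowth : Submodule ℝ (ℝ × ℝ → ℝ) where
  carrier := {c | ∃ C, ∀ p : ℝ × ℝ, |c p| ≤ C * (1 + |p.1| + |p.2|)}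
  zero_mem' := ⟨0, fun p => by simp⟩
  add_mem' := by
    rintro c d ⟨C, hC⟩ ⟨D, hD⟩
    refine ⟨C + D, fun p => (abs_add_le _ _).trans ?_⟩
    rw [add_mul]
    exact add_le_add (hC p) (hD p)
  smul_mem' := by
    rintro r c ⟨C, hC⟩
    refine ⟨|r| * C, fun p => ?_⟩
    rw [Pi.smul_apply, smul_eq_mul, abs_mul, mul_assoc]
    exact mul_le_mul_of_nonneg_left (hC p) (abs_nonneg _)

/-- The cone of nonnegative functions of linear growth. -/
def linearGrowthCone : PointedCone ℝ linearGrowth where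
  carrier := {c | ∀ p, 0 ≤ c.1 p}
  zero_mem' := fun _ => le_rfl
  add_mem' := fun hc hd p => add_nonneg (hc p) (hd p)
  smul_mem' := fun r _ hc p => mul_nonneg r.2 (hc p)

/-- The graph of `f(x) + g(y) + k(x)(y - x) ↦ μ(f) + ν(g)`. -/
def hedgeGraph (μ ν : Measure ℝ) : Submodule ℝ (linearGrowth × ℝ) where
  carrier := {q | ∃ f g k : ℝ → ℝ, Integrable f μ ∧ Integrable g ν ∧
    (∀ x y, q.1.1 (x, y) = f x + g y + k x * (y - x)) ∧ q.2 = ∫ x, f x ∂μ + ∫ y, g y ∂ν}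
  zero_mem' := ⟨0, 0, 0, integrable_zero _ _ _, integrable_zero _ _ _, fun x y => by simp, by simp⟩
  add_mem' := by
    rintro q q' ⟨f, g, k, hf, hg, h1, h2⟩ ⟨f', g', k', hf', hg', h1', h2'⟩
    refine ⟨f + f', g + g', k + k', hf.add hf', hg.add hg', fun x y => ?_, ?_⟩
    · have : (q + q').1.1 (x, y) = q.1.1 (x, y) + q'.1.1 (x, y) := rfl
      rw [this, h1, h1']
      simp only [Pi.add_apply]
      ring
    · rw [integral_add' hf hf', integral_add' hg hg', Prod.snd_add, h2, h2']
      ring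
  smul_mem' := by
    rintro r q ⟨f, g, k, hf, hg, h1, h2⟩
    refine ⟨fun x => r * f x, fun x => r * g x, fun x => r * k x, hf.const_mul r, hg.const_mul r,
      fun x y => ?_, ?_⟩
    · have : (r • q).1.1 (x, y) = r * q.1.1 (x, y) := rfl
      rw [this, h1]
      ring
    · rw [integral_const_mul, integral_const_mul, Prod.smul_snd, h2, smul_eq_mul]
      ring

/-- By weak duality `μ(f) + ν(g)` is a well-defined positive functional on the functions `f(x) +
g(y) + k(x)(y - x)`; M. Riesz's theorem extends it. Vanishing on `k(x)(y - x)` encodes the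
martingale property. -/
theorem ConvexOrder.exists_positive_functional {μ ν : Measure ℝ} (h : ConvexOrder μ ν) :
    ∃ Λ : linearGrowth →ₗ[ℝ] ℝ, (∀ c : linearGrowth, (∀ p, 0 ≤ c.1 p) → 0 ≤ Λ c) ∧
      ∀ (c : linearGrowth) (f g k : ℝ → ℝ), Integrable f μ → Integrable g ν →
        (∀ x y, c.1 (x, y) = f x + g y + k x * (y - x)) →
          Λ c = ∫ x, f x ∂μ + ∫ y, g y ∂ν := by
  have := h.left.finite
  have := h.right.finite
  have hnonneg : ∀ q ∈ hedgeGraph μ ν, (∀ p, 0 ≤ q.1.1 p) → 0 ≤ q.2 := by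
    rintro q ⟨f, g, k, hf, hg, h1, h2⟩ hq
    rw [h2]
    exact h.integral_add_integral_nonneg hf hg fun x y => h1 x y ▸ hq (x, y)
  -- Positivity applied to `q` and `-q` makes the graph single-valued, so the value does not depend
  -- on the choice of `f`, `g`, `k`.
  have hgr : ∀ q ∈ hedgeGraph μ ν, q.1 = 0 → q.2 = 0 := by
    intro q hq hq0
    refine le_antisymm ?_ (hnonneg q hq fun p => by rw [hq0]; exact le_rfl)
    have := hnonneg (-q) (neg_mem hq) fun p => by
      have : (-q).1 = 0 := by rw [Prod.fst_neg, hq0, neg_zero]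
      rw [this]; exact le_rfl
    rw [Prod.snd_neg] at this
    linarith
  obtain ⟨Λ, hΛ1, hΛ2⟩ := riesz_extension linearGrowthCone (hedgeGraph μ ν).toLinearPMap
    (fun x hx => hnonneg _ (Submodule.mem_graph_toLinearPMap hgr x) hx) (by
      rintro ⟨c, C, hC⟩
      have habs : ∀ (m : Measure ℝ), FiniteFirstMoment m →
          Integrable (fun x : ℝ => |C| * |x|) m := fun m hm => hm.moment.abs.const_mul _
      -- Riesz extension requires every `c` to be dominated from the subspace; `|C| (1 + |x| + |y|)`
      -- has the form `f(x) + g(y)`.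
      let w : linearGrowth := ⟨fun p => |C| * (1 + |p.1| + |p.2|), |C|, fun p => by
        rw [abs_of_nonneg (by positivity)]⟩
      refine ⟨⟨w, Submodule.mem_map.2 ⟨(w, _), ⟨fun x => |C| + |C| * |x|, fun x => |C| * |x|, 0,
        (integrable_const _).add (habs _ h.left), habs _ h.right, fun x y => ?_, rfl⟩, rfl⟩⟩, ?_⟩
      · simp only [w, Pi.zero_apply]
        ring
      · intro p
        have h1 := (neg_le_of_abs_le (hC p))
        have h2 : C * (1 + |p.1| + |p.2|) ≤ |C| * (1 + |p.1| + |p.2|) :=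
          mul_le_mul_of_nonneg_right (le_abs_self _) (by positivity)
        change 0 ≤ |C| * (1 + |p.1| + |p.2|) + c p
        linarith)
  refine ⟨Λ, hΛ2, fun c f g k hf hg hc => ?_⟩
  have hmem : (c, ∫ x, f x ∂μ + ∫ y, g y ∂ν) ∈ hedgeGraph μ ν := ⟨f, g, k, hf, hg, hc, rfl⟩
  rw [← Submodule.toLinearPMap_graph_eq _ hgr, LinearPMap.mem_graph_iff] at hmem
  obtain ⟨y, hy1, hy2⟩ := hmem
  change (y : linearGrowth) = c at hy1
  rw [← hy1, hΛ1, hy2]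

/-! ### Truncation, and the passage from the functional to a measure. -/

/-- Continuous cutoff functions on the plane. -/
noncomputable def cutoff (n : ℕ) (p : ℝ × ℝ) : ℝ :=
  max 0 (min 1 (2 - (|p.1| + |p.2|) / (n + 1)))

theorem continuous_cutoff (n : ℕ) : Continuous (cutoff n) := by
  unfold cutoff
  fun_prop

theorem cutoff_nonneg (n : ℕ) (p : ℝ × ℝ) : 0 ≤ cutoff n p := le_max_left _ _

theorem cutoff_le_one (n : ℕ) (p : ℝ × ℝ) : cutoff n p ≤ 1 := max_le zero_le_one (min_le_left _ _)

theorem cutoff_eq_one {n : ℕ} {p : ℝ × ℝ} (h : |p.1| + |p.2| ≤ n + 1) : cutoff n p = 1 := by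
  have hn : (0 : ℝ) < n + 1 := by positivity
  have : (|p.1| + |p.2|) / (n + 1) ≤ 1 := (div_le_one hn).2 h
  rw [cutoff, min_eq_left (by linarith), max_eq_right zero_le_one]

theorem hasCompactSupport_cutoff (n : ℕ) : HasCompactSupport (cutoff n) := by
  have hn : (0 : ℝ) < n + 1 := by positivity
  refine HasCompactSupport.intro (isCompact_closedBall (0 : ℝ × ℝ) (2 * (n + 1))) fun p hp => ?_
  rw [mem_closedBall_zero_iff, not_le, Prod.norm_def, Real.norm_eq_abs, Real.norm_eq_abs] at hp
  have h1 : 2 * ((n : ℝ) + 1) ≤ |p.1| + |p.2| :=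
    hp.le.trans (max_le (le_add_of_nonneg_right (abs_nonneg _))
      (le_add_of_nonneg_left (abs_nonneg _)))
  rw [← le_div_iff₀ hn] at h1
  exact max_eq_left ((min_le_right _ _).trans (by linarith))

theorem tendsto_cutoff (p : ℝ × ℝ) : Tendsto (fun n => cutoff n p) atTop (𝓝 1) := by
  refine tendsto_const_nhds.congr' ?_
  obtain ⟨N, hN⟩ := exists_nat_ge (|p.1| + |p.2|)
  filter_upwards [eventually_ge_atTop N] with n hn
  refine (cutoff_eq_one (hN.trans ?_)).symm
  have : (N : ℝ) ≤ n := by exact_mod_cast hn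
  linarith

/-- The excess of `|x|` over the level `(n + 1) / 4`. -/
noncomputable def tail (n : ℕ) (x : ℝ) : ℝ := max 0 (|x| - (n + 1) / 4)

theorem tail_nonneg (n : ℕ) (x : ℝ) : 0 ≤ tail n x := le_max_left _ _

theorem abs_tail_le (n : ℕ) (x : ℝ) : |tail n x| ≤ |x| := by
  rw [abs_of_nonneg (tail_nonneg n x)]
  refine max_le (abs_nonneg _) ?_
  have : (0 : ℝ) ≤ (n + 1) / 4 := by positivity
  linarith

theorem measurable_tail (n : ℕ) : Measurable (tail n) := by
  unfold tail
  fun_prop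

theorem FiniteFirstMoment.integrable_tail {μ : Measure ℝ} (hμ : FiniteFirstMoment μ) (n : ℕ) :
    Integrable (tail n) μ :=
  hμ.moment.mono (measurable_tail n).aestronglyMeasurable (ae_of_all _ fun x => abs_tail_le n x)

theorem FiniteFirstMoment.tendsto_integral_tail {μ : Measure ℝ} (hμ : FiniteFirstMoment μ) :
    Tendsto (fun n => ∫ x, tail n x ∂μ) atTop (𝓝 0) := by
  have := tendsto_integral_of_dominated_convergence (μ := μ) (F := tail) (f := fun _ => 0)
    (fun x => |x|) (fun n => (measurable_tail n).aestronglyMeasurable) hμ.moment.abs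
    (fun n => ae_of_all _ fun x => abs_tail_le n x) (ae_of_all _ fun x => by
      refine tendsto_const_nhds.congr' ?_
      obtain ⟨N, hN⟩ := exists_nat_ge (4 * |x|)
      filter_upwards [eventually_ge_atTop N] with n hn
      have : (N : ℝ) ≤ n := by exact_mod_cast hn
      exact (max_eq_left (by linarith)).symm)
  simpa using this

/-- Where the cutoff is not `1`, the larger coordinate `a` (in absolute value) exceeds `(n + 1) / 2
≥ 1 / 2`. So `1 + |x| + |y| ≤ 4 a`, and `a` is at most twice its own tail, whence the `8`. The bound
is a sum of functions of one variable, on which the functional is known. -/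
theorem mul_one_sub_cutoff_le (n : ℕ) (p : ℝ × ℝ) :
    (1 + |p.1| + |p.2|) * (1 - cutoff n p) ≤ 8 * (tail n p.1 + tail n p.2) := by
  have h1 := tail_nonneg n p.1
  have h2 := tail_nonneg n p.2
  rcases le_or_gt (|p.1| + |p.2|) (n + 1) with h | h
  · rw [cutoff_eq_one h, sub_self, mul_zero]
    positivity
  · have hn : (0 : ℝ) ≤ n := by positivity
    have h3 : |p.1| - (n + 1) / 4 ≤ tail n p.1 := le_max_right _ _
    have h4 : |p.2| - (n + 1) / 4 ≤ tail n p.2 := le_max_right _ _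
    have h5 : (1 + |p.1| + |p.2|) * (1 - cutoff n p) ≤ 1 + |p.1| + |p.2| :=
      mul_le_of_le_one_right (by positivity) (by linarith [cutoff_nonneg n p])
    rcases le_total |p.1| |p.2| with h6 | h6 <;> linarith

theorem mul_cutoff_mem_linearGrowth {c : ℝ × ℝ → ℝ} (hc : c ∈ linearGrowth) (n : ℕ) :
    (fun p => c p * cutoff n p) ∈ linearGrowth := by
  obtain ⟨C, hC⟩ := hc
  refine ⟨C, fun p => ?_⟩
  rw [abs_mul, abs_of_nonneg (cutoff_nonneg n p)]
  exact (mul_le_of_le_one_right (abs_nonneg _) (cutoff_le_one n p)).trans (hC p)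

theorem compactlySupported_mem_linearGrowth (c : CompactlySupportedContinuousMap (ℝ × ℝ) ℝ) :
    (c : ℝ × ℝ → ℝ) ∈ linearGrowth := by
  obtain ⟨C, hC⟩ := c.hasCompactSupport.exists_bound_of_continuous c.continuous
  refine ⟨C, fun p => (hC p).trans ?_⟩
  have h1 : 0 ≤ C := (norm_nonneg _).trans (hC p)
  have h2 := abs_nonneg p.1
  have h3 := abs_nonneg p.2
  exact le_mul_of_one_le_right h1 (by linarith)

/-- The restriction of a functional to the compactly supported continuous functions. -/
def restrictCompactlySupported (Λ : linearGrowth →ₗ[ℝ] ℝ) :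
    CompactlySupportedContinuousMap (ℝ × ℝ) ℝ →ₗ[ℝ] ℝ where
  toFun c := Λ ⟨c, compactlySupported_mem_linearGrowth c⟩
  map_add' c d := by rw [← map_add]; rfl
  map_smul' r c := by rw [RingHom.id_apply, ← map_smul]; rfl

/-- The function `1 + |x| + |y|`. -/
def growthWeight (p : ℝ × ℝ) : ℝ := 1 + |p.1| + |p.2|

theorem growthWeight_pos (p : ℝ × ℝ) : 0 < growthWeight p := by
  unfold growthWeight
  positivity

theorem continuous_growthWeight : Continuous growthWeight := by
  unfold growthWeight
  fun_prop

theorem growthWeight_mem : growthWeight ∈ linearGrowth :=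
  ⟨1, fun p => by rw [abs_of_pos (growthWeight_pos p), one_mul, growthWeight]⟩

/-- A martingale coupling, in functional form. -/
theorem ConvexOrder.exists_coupling_integral {μ ν : Measure ℝ} (h : ConvexOrder μ ν) :
    ∃ π : Measure (ℝ × ℝ), Integrable growthWeight π ∧
      ∀ (c : linearGrowth) (f g k : ℝ → ℝ), Continuous c.1 → Integrable f μ → Integrable g ν →
        (∀ x y, c.1 (x, y) = f x + g y + k x * (y - x)) →
          ∫ p, c.1 p ∂π = ∫ x, f x ∂μ + ∫ y, g y ∂ν := by
  obtain ⟨Λ, hΛ, hrep⟩ := h.exists_positive_functional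
  let Λc : CompactlySupportedContinuousMap (ℝ × ℝ) ℝ →ₚ[ℝ] ℝ :=
    PositiveLinearMap.mk₀ (restrictCompactlySupported Λ) fun c hc => hΛ _ fun p => hc p
  let π := RealRMK.rieszMeasure Λc
  have hmono : ∀ c d : linearGrowth, (∀ p, c.1 p ≤ d.1 p) → Λ c ≤ Λ d := fun c d hcd => by
    have := hΛ (d - c) fun p => sub_nonneg.2 (hcd p)
    rw [map_sub] at this
    linarith
  have hcut : ∀ (c : linearGrowth) (n : ℕ), Continuous c.1 →
      ∫ p, c.1 p * cutoff n p ∂π = Λ ⟨_, mul_cutoff_mem_linearGrowth c.2 n⟩ := by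
    intro c n hc
    exact RealRMK.integral_rieszMeasure Λc ⟨⟨fun p => c.1 p * cutoff n p,
      hc.mul (continuous_cutoff n)⟩, (hasCompactSupport_cutoff n).mul_left⟩
  have htail : ∀ n, ∃ d : linearGrowth, (∀ p, d.1 p = 8 * (tail n p.1 + tail n p.2)) ∧
      Λ d = 8 * (∫ x, tail n x ∂μ + ∫ x, tail n x ∂ν) := by
    intro n
    refine ⟨⟨fun p => 8 * (tail n p.1 + tail n p.2), 8, fun p => ?_⟩, fun p => rfl, ?_⟩
    · have h1 := abs_tail_le n p.1
      have h2 := abs_tail_le n p.2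
      have h3 := abs_add_le (tail n p.1) (tail n p.2)
      rw [abs_mul, abs_of_pos (by norm_num : (0 : ℝ) < 8)]
      linarith
    · rw [hrep _ (fun x => 8 * tail n x) (fun x => 8 * tail n x) 0
        ((h.left.integrable_tail n).const_mul 8) ((h.right.integrable_tail n).const_mul 8)
        fun x y => by simp only [Pi.zero_apply]; ring]
      rw [integral_const_mul, integral_const_mul]
      ring
  -- The functional loses no mass at infinity: by positivity the truncation error is at most `8 |C|`
  -- times the sum of the tail integrals under `μ` and `ν`.
  have hlim : ∀ c : linearGrowth,
      Tendsto (fun n => Λ ⟨_, mul_cutoff_mem_linearGrowth c.2 n⟩) atTop (𝓝 (Λ c)) := by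
    rintro ⟨c, hc⟩
    obtain ⟨C, hC⟩ := hc
    have hC' : ∀ p, |c p| ≤ |C| * (1 + |p.1| + |p.2|) := fun p =>
      (hC p).trans (mul_le_mul_of_nonneg_right (le_abs_self _) (by positivity))
    have hb : Tendsto (fun n => |C| * (8 * (∫ x, tail n x ∂μ + ∫ x, tail n x ∂ν))) atTop (𝓝 0) := by
      have := ((h.left.tendsto_integral_tail.add h.right.tendsto_integral_tail).const_mul 8).const_mul
        |C|
      simpa using this
    rw [tendsto_iff_norm_sub_tendsto_zero]
    refine squeeze_zero (fun _ => norm_nonneg _) (fun n => ?_) hb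
    obtain ⟨d, hd, hΛd⟩ := htail n
    rw [Real.norm_eq_abs, ← map_sub, ← hΛd, ← smul_eq_mul, ← map_smul]
    have key : ∀ p, |c p * cutoff n p - c p| ≤ |C| * d.1 p := fun p => by
      have e : c p * cutoff n p - c p = -(c p * (1 - cutoff n p)) := by ring
      have h1 : 0 ≤ 1 - cutoff n p := by linarith [cutoff_le_one n p]
      rw [e, abs_neg, abs_mul, abs_of_nonneg h1, hd]
      refine (mul_le_mul_of_nonneg_right (hC' p) h1).trans ?_
      rw [mul_assoc]
      exact mul_le_mul_of_nonneg_left (mul_one_sub_cutoff_le n p) (abs_nonneg _)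
    rw [abs_le]
    constructor
    · rw [← map_neg]
      exact hmono _ _ fun p => neg_le_of_abs_le (key p)
    · exact hmono _ _ fun p => le_of_abs_le (key p)
  have hint : Integrable growthWeight π := by
    refine ⟨continuous_growthWeight.aestronglyMeasurable, ?_⟩
    -- Fatou along the cutoffs: each truncated integral is bounded by the functional at
    -- `growthWeight`.
    have hF : ∀ p, ‖growthWeight p‖ₑ =
        liminf (fun n => ENNReal.ofReal (growthWeight p * cutoff n p)) atTop := fun p => by
      have h1 := (tendsto_cutoff p).const_mul (growthWeight p)
      rw [mul_one] at h1
      rw [(ENNReal.tendsto_ofReal h1).liminf_eq, Real.enorm_eq_ofReal (growthWeight_pos p).le]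
    have hi : ∀ n, Integrable (fun p => growthWeight p * cutoff n p) π := fun n =>
      (continuous_growthWeight.mul (continuous_cutoff n)).integrable_of_hasCompactSupport
        (hasCompactSupport_cutoff n).mul_left
    have hle : ∀ n, ∫⁻ p, ENNReal.ofReal (growthWeight p * cutoff n p) ∂π ≤
        ENNReal.ofReal (Λ ⟨_, growthWeight_mem⟩) := fun n => by
      rw [← ofReal_integral_eq_lintegral_ofReal (hi n) (ae_of_all _ fun p =>
        mul_nonneg (growthWeight_pos p).le (cutoff_nonneg n p)),
        hcut ⟨_, growthWeight_mem⟩ n continuous_growthWeight]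
      exact ENNReal.ofReal_le_ofReal (hmono _ _ fun p =>
        mul_le_of_le_one_right (growthWeight_pos p).le (cutoff_le_one n p))
    calc ∫⁻ p, ‖growthWeight p‖ₑ ∂π
        = ∫⁻ p, liminf (fun n => ENNReal.ofReal (growthWeight p * cutoff n p)) atTop ∂π :=
          lintegral_congr hF
      _ ≤ liminf (fun n => ∫⁻ p, ENNReal.ofReal (growthWeight p * cutoff n p) ∂π) atTop :=
          lintegral_liminf_le fun n =>
            (continuous_growthWeight.mul (continuous_cutoff n)).measurable.ennreal_ofReal
      _ ≤ ENNReal.ofReal (Λ ⟨_, growthWeight_mem⟩) :=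
          liminf_le_of_frequently_le' (Frequently.of_forall hle)
      _ < ⊤ := ENNReal.ofReal_lt_top
  refine ⟨π, hint, fun c f g k hc hf hg hcfg => ?_⟩
  rw [← hrep c f g k hf hg hcfg]
  obtain ⟨C, hC⟩ := c.2
  refine tendsto_nhds_unique ?_ (hlim c)
  simp_rw [← fun n => hcut c n hc]
  refine tendsto_integral_of_dominated_convergence (fun p => C * growthWeight p)
    (fun n => (hc.mul (continuous_cutoff n)).aestronglyMeasurable) (hint.const_mul C)
    (fun n => ae_of_all _ fun p => ?_) (ae_of_all _ fun p => ?_)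
  · rw [norm_mul, Real.norm_eq_abs, Real.norm_eq_abs, abs_of_nonneg (cutoff_nonneg n p)]
    exact (mul_le_of_le_one_right (abs_nonneg _) (cutoff_le_one n p)).trans (hC p)
  · simpa using (tendsto_cutoff p).const_mul (c.1 p)

/-! ### Strassen's theorem by disintegration. -/

/-- A Markov kernel that, `μ`-almost everywhere, is centred at its starting point. -/
structure IsMartingaleKernel (μ : Measure ℝ) (κ : Kernel ℝ ℝ) : Prop where
  markov : IsMarkovKernel κ
  integrable : ∀ᵐ x ∂μ, Integrable (fun y : ℝ => y) (κ x)
  mean : ∀ᵐ x ∂μ, ∫ y, y ∂κ x = x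

/-- Strassen's theorem on the real line. -/
theorem ConvexOrder.exists_martingaleKernel {μ ν : Measure ℝ} (h : ConvexOrder μ ν) :
    ∃ κ : Kernel ℝ ℝ, IsMartingaleKernel μ κ ∧ μ.bind κ = ν := by
  have := h.left.finite
  have := h.right.finite
  obtain ⟨π, hint, hrep⟩ := h.exists_coupling_integral
  have hfin : IsFiniteMeasure π := by
    have h1 : Integrable (fun _ : ℝ × ℝ => (1 : ℝ)) π :=
      hint.mono' aestronglyMeasurable_const (ae_of_all _ fun p => by
        rw [norm_one, growthWeight]
        linarith [abs_nonneg p.1, abs_nonneg p.2])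
    exact ((integrable_const_iff).1 h1).resolve_left one_ne_zero
  have hi1 : Integrable (fun p : ℝ × ℝ => p.1) π :=
    hint.mono' (by fun_prop) (ae_of_all _ fun p => by
      rw [Real.norm_eq_abs, growthWeight]
      linarith [abs_nonneg p.1, abs_nonneg p.2])
  have hi2 : Integrable (fun p : ℝ × ℝ => p.2) π :=
    hint.mono' (by fun_prop) (ae_of_all _ fun p => by
      rw [Real.norm_eq_abs, growthWeight]
      linarith [abs_nonneg p.1, abs_nonneg p.2])
  have hbd : ∀ (f : BoundedContinuousFunction ℝ ℝ) (p : ℝ × ℝ) (x : ℝ),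
      |f x| ≤ ‖f‖ * (1 + |p.1| + |p.2|) := fun f p x =>
    (f.norm_coe_le_norm x).trans (le_mul_of_one_le_right (norm_nonneg _)
      (by linarith [abs_nonneg p.1, abs_nonneg p.2]))
  have hfst : π.fst = μ := by
    refine ext_of_forall_integral_eq_of_IsFiniteMeasure fun f => ?_
    rw [Measure.fst, integral_map measurable_fst.aemeasurable f.continuous.aestronglyMeasurable]
    have := hrep ⟨fun p => f p.1, ‖f‖, fun p => hbd f p p.1⟩ f 0 0 (by fun_prop)
      (f.integrable μ) (integrable_zero _ _ _) (by simp)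
    simpa using this
  have hsnd : π.snd = ν := by
    refine ext_of_forall_integral_eq_of_IsFiniteMeasure fun f => ?_
    rw [Measure.snd, integral_map measurable_snd.aemeasurable f.continuous.aestronglyMeasurable]
    have := hrep ⟨fun p => f p.2, ‖f‖, fun p => hbd f p p.2⟩ 0 f 0 (by fun_prop)
      (integrable_zero _ _ _) (f.integrable ν) (by simp)
    simpa using this
  have hdis : μ ⊗ₘ π.condKernel = π := by
    rw [← hfst]; exact π.disintegrate π.condKernel
  have hi2' := hi2
  rw [← hdis, Measure.integrable_compProd_iff (by fun_prop)] at hi2'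
  have hI : Integrable (fun x => ∫ y, y ∂π.condKernel x) μ := by
    exact hi2'.2.mono measurable_id.stronglyMeasurable.integral_kernel.aestronglyMeasurable
      (ae_of_all _ fun x => by
      rw [Real.norm_of_nonneg (integral_nonneg fun _ => norm_nonneg _)]
      exact norm_integral_le_integral_norm _)
  refine ⟨π.condKernel, ⟨inferInstance, hi2'.1, ?_⟩, ?_⟩
  -- Testing against `k(x)(y - x)` with `k` smooth and compactly supported shows that the
  -- conditional mean minus `x` vanishes almost everywhere.
  · have hz : ∀ᵐ x ∂μ, ∫ y, y ∂π.condKernel x - x = 0 := by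
      refine ae_eq_zero_of_integral_contDiff_smul_eq_zero (hI.sub h.left.moment).locallyIntegrable ?_
      intro k hk hks
      obtain ⟨C, hC⟩ := hks.exists_bound_of_continuous hk.continuous
      have hkc := hk.continuous
      have h0 := hrep ⟨fun p => k p.1 * (p.2 - p.1), C, fun p => ?_⟩ 0 0 k
        (show Continuous fun p : ℝ × ℝ => k p.1 * (p.2 - p.1) by fun_prop)
        (integrable_zero _ _ _) (integrable_zero _ _ _) (by simp)
      · simp only [Pi.zero_apply, integral_zero, add_zero] at h0
        have hprod : Integrable (fun p : ℝ × ℝ => k p.1 * (p.2 - p.1)) (μ ⊗ₘ π.condKernel) := by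
          rw [hdis]
          exact (hi2.sub hi1).bdd_mul (c := C) (by fun_prop) (ae_of_all _ fun p => hC _)
        rw [← hdis, Measure.integral_compProd hprod] at h0
        rw [← h0]
        refine integral_congr_ae ?_
        filter_upwards [hi2'.1] with x hx
        simp only [smul_eq_mul]
        rw [integral_const_mul, integral_sub hx (integrable_const x), integral_const,
          probReal_univ, one_smul]
      · have h1 : |p.2 - p.1| ≤ 1 + |p.1| + |p.2| := by
          linarith [abs_sub p.2 p.1]
        rw [abs_mul]
        exact mul_le_mul (hC _) h1 (abs_nonneg _) ((norm_nonneg _).trans (hC p.1))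
    filter_upwards [hz] with x hx
    linarith
  · rw [← Measure.snd_compProd, hdis, hsnd]

/-! ### Three-step martingales. -/

/-- The law of a three-step martingale with marginals `μ`, `θ`, `ν`. -/
structure IsThreeStepLaw (μ θ ν : Measure ℝ) (Q : Measure ((ℝ × ℝ) × ℝ)) : Prop where
  finite : IsFiniteMeasure Q
  map_first : Q.map (fun p => p.1.1) = μ
  map_second : Q.map (fun p => p.1.2) = θ
  map_third : Q.map (fun p => p.2) = ν
  integrable_first : Integrable (fun p => p.1.1) Q
  integrable_second : Integrable (fun p => p.1.2) Q
  integrable_third : Integrable (fun p => p.2) Q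
  first_step : ∀ C : Set ℝ, MeasurableSet C →
    ∫ p in (fun p : (ℝ × ℝ) × ℝ => p.1.1) ⁻¹' C, p.1.2 ∂Q =
      ∫ p in (fun p : (ℝ × ℝ) × ℝ => p.1.1) ⁻¹' C, p.1.1 ∂Q
  second_step : ∀ C : Set (ℝ × ℝ), MeasurableSet C →
    ∫ p in (fun p : (ℝ × ℝ) × ℝ => p.1) ⁻¹' C, p.2 ∂Q =
      ∫ p in (fun p : (ℝ × ℝ) × ℝ => p.1) ⁻¹' C, p.1.2 ∂Q

theorem setIntegral_snd_compProd {α : Type*} [MeasurableSpace α] {ρ : Measure α}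
    [IsFiniteMeasure ρ] {η : Kernel α ℝ} [IsMarkovKernel η] {g : α → ℝ} (hg : Measurable g)
    (hmean : ∀ᵐ a ∂ρ, ∫ y, y ∂η a = g a) (hi : Integrable (fun p : α × ℝ => p.2) (ρ ⊗ₘ η))
    {C : Set α} (hC : MeasurableSet C) :
    ∫ p in Prod.fst ⁻¹' C, p.2 ∂(ρ ⊗ₘ η) = ∫ p in Prod.fst ⁻¹' C, g p.1 ∂(ρ ⊗ₘ η) := by
  have h1 : ∫ p in Prod.fst ⁻¹' C, p.2 ∂(ρ ⊗ₘ η) = ∫ a in C, ∫ y, y ∂η a ∂ρ := by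
    rw [← prod_univ, Measure.setIntegral_compProd hC MeasurableSet.univ hi.integrableOn]
    simp only [Measure.restrict_univ]
  have h2 : ∫ p in Prod.fst ⁻¹' C, g p.1 ∂(ρ ⊗ₘ η) = ∫ a in C, g a ∂ρ := by
    have h3 : (ρ ⊗ₘ η).map Prod.fst = ρ := Measure.fst_compProd ρ η
    conv_rhs => rw [← h3]
    rw [setIntegral_map hC hg.aestronglyMeasurable measurable_fst.aemeasurable]
  rw [h1, h2]
  exact integral_congr_ae (ae_restrict_of_ae hmean)

/-- The Markov chain started from `μ` with transitions `κ₁`, `κ₂`; `prodMkLeft` makes the second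
transition forget the first coordinate. -/
theorem exists_threeStepLaw {μ θ ν : Measure ℝ} {κ₁ κ₂ : Kernel ℝ ℝ} (hμ : FiniteFirstMoment μ)
    (hθ : FiniteFirstMoment θ) (hν : FiniteFirstMoment ν) (h1 : IsMartingaleKernel μ κ₁)
    (h2 : IsMartingaleKernel θ κ₂) (hb1 : μ.bind κ₁ = θ) (hb2 : θ.bind κ₂ = ν) :
    ∃ Q, IsThreeStepLaw μ θ ν Q := by
  have := hμ.finite
  have := h1.markov
  have := h2.markov
  set ρ := μ ⊗ₘ κ₁ with hρ
  set Q := ρ ⊗ₘ (κ₂.prodMkLeft ℝ) with hQ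
  have e1 : ρ.map Prod.fst = μ := Measure.fst_compProd μ κ₁
  have e2 : ρ.map Prod.snd = θ := (Measure.snd_compProd μ κ₁).trans hb1
  have e3 : Q.map Prod.fst = ρ := Measure.fst_compProd ρ _
  have m1 : Q.map (fun p => p.1.1) = μ := by
    rw [← e1, ← e3, Measure.map_map measurable_fst measurable_fst]; rfl
  have m2 : Q.map (fun p => p.1.2) = θ := by
    rw [← e2, ← e3, Measure.map_map measurable_snd measurable_fst]; rfl
  have m3 : Q.map (fun p => p.2) = ν := by
    refine (Measure.snd_compProd ρ _).trans ?_
    rw [← hb2, ← e2]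
    ext s hs
    rw [Measure.bind_apply hs (Kernel.aemeasurable _), Measure.bind_apply hs (Kernel.aemeasurable _),
      lintegral_map (Kernel.measurable_coe _ hs) measurable_snd]
    rfl
  have i1 : Integrable (fun p : (ℝ × ℝ) × ℝ => p.1.1) Q := by
    have h := hμ.moment
    rw [← m1] at h
    exact h.comp_measurable (by fun_prop)
  have i2 : Integrable (fun p : (ℝ × ℝ) × ℝ => p.1.2) Q := by
    have h := hθ.moment
    rw [← m2] at h
    exact h.comp_measurable (by fun_prop)
  have i3 : Integrable (fun p : (ℝ × ℝ) × ℝ => p.2) Q := by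
    have h := hν.moment
    rw [← m3] at h
    exact h.comp_measurable (by fun_prop)
  refine ⟨Q, inferInstance, m1, m2, m3, i1, i2, i3, fun C hC => ?_, fun C hC => ?_⟩
  · have hi : Integrable (fun p : ℝ × ℝ => p.2) ρ := by
      rw [← e3]
      exact (integrable_map_measure (by fun_prop) (by fun_prop)).2 i2
    have h := setIntegral_snd_compProd measurable_id h1.mean hi hC
    rw [← hρ, ← e3, setIntegral_map (measurable_fst hC) (by fun_prop) (by fun_prop),
      setIntegral_map (measurable_fst hC) (by fun_prop) (by fun_prop)] at h
    exact h
  · refine setIntegral_snd_compProd measurable_snd ?_ i3 hC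
    have h := h2.mean
    rw [← e2] at h
    exact ae_of_ae_map measurable_snd.aemeasurable h

/-! ### Step paths in the Skorokhod space. -/

/-- The path equal to `a` on `[0, t)`, to `b` on `[t, T)` and to `c` at time `T`. -/
noncomputable def stepPath {T t : ℝ} (ht : t < T) (p : (ℝ × ℝ) × ℝ) : CadlagPath T where
  toFun s := if (s : ℝ) = T then p.2 else if (s : ℝ) < t then p.1.1 else p.1.2
  right_cont s := by
    refine ContinuousWithinAt.congr_of_eventuallyEq
      (f := fun _ => if (s : ℝ) = T then p.2 else if (s : ℝ) < t then p.1.1 else p.1.2)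
      continuousWithinAt_const ?_ rfl
    rcases eq_or_lt_of_le s.2.2 with h | h
    · filter_upwards [self_mem_nhdsWithin] with u hu
      have : u = s := le_antisymm (Subtype.coe_le_coe.1 (u.2.2.trans_eq h.symm)) hu
      rw [this]
    · have hT : ∀ᶠ u : Icc (0 : ℝ) T in 𝓝[≥] s, (u : ℝ) < T :=
        (continuous_subtype_val.continuousWithinAt).eventually_lt_const h
      rcases lt_or_ge (s : ℝ) t with h' | h'
      · have h2 : ∀ᶠ u : Icc (0 : ℝ) T in 𝓝[≥] s, (u : ℝ) < t :=
          (continuous_subtype_val.continuousWithinAt).eventually_lt_const h'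
        filter_upwards [hT, h2] with u hu hu2
        simp [hu.ne, hu2, h.ne, h']
      · filter_upwards [hT, self_mem_nhdsWithin] with u hu hu2
        have h3 : t ≤ u := h'.trans (Subtype.coe_le_coe.2 hu2)
        simp [hu.ne, h.ne, h'.not_gt, h3.not_gt]
  left_lim s := by
    -- At `s = 0` the filter `𝓝[<] s` is `⊥`, so any value serves as left limit.
    rcases le_or_gt (s : ℝ) t with h | h
    · refine ⟨p.1.1, tendsto_const_nhds.congr' ?_⟩
      filter_upwards [self_mem_nhdsWithin] with u hu
      have h1 : (u : ℝ) < s := Subtype.coe_lt_coe.2 hu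
      rw [if_neg (by linarith), if_pos (by linarith)]
    · refine ⟨p.1.2, tendsto_const_nhds.congr' ?_⟩
      have h2 : ∀ᶠ u : Icc (0 : ℝ) T in 𝓝[<] s, t < (u : ℝ) :=
        (continuous_subtype_val.continuousWithinAt).eventually_const_lt h
      filter_upwards [self_mem_nhdsWithin, h2] with u hu hu2
      have h1 : (u : ℝ) < s := Subtype.coe_lt_coe.2 hu
      have := s.2.2
      rw [if_neg (by linarith), if_neg (by linarith)]

theorem X_stepPath_of_lt {T t : ℝ} (ht : t < T) {s : Icc (0 : ℝ) T} (hs : (s : ℝ) < t) :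
    X s ∘ stepPath ht = fun p => p.1.1 := by
  ext p
  simp [X, stepPath, (hs.trans ht).ne, hs]

theorem X_stepPath_of_le {T t : ℝ} (ht : t < T) {s : Icc (0 : ℝ) T} (hs : t ≤ (s : ℝ))
    (hsT : (s : ℝ) < T) : X s ∘ stepPath ht = fun p => p.1.2 := by
  ext p
  simp [X, stepPath, hsT.ne, hs.not_gt]

theorem X_stepPath_of_eq {T t : ℝ} (ht : t < T) {s : Icc (0 : ℝ) T} (hs : (s : ℝ) = T) :
    X s ∘ stepPath ht = fun p => p.2 := by
  ext p
  simp [X, stepPath, hs]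

/-- The identity time change already bounds the Skorokhod distance, so the map is 1-Lipschitz. -/
theorem continuous_stepPath {T t : ℝ} (ht : t < T) : Continuous (stepPath ht) := by
  refine LipschitzWith.continuous (K := 1) fun p q => ?_
  rw [ENNReal.coe_one, one_mul]
  refine (iInf_le _ (OrderIso.refl _)).trans (max_le (iSup_le fun s => by simp) (iSup_le fun s => ?_))
  simp only [OrderIso.refl_apply, stepPath]
  rw [Prod.edist_eq p, Prod.edist_eq p.1]
  split_ifs
  · exact le_max_right _ _
  · exact (le_max_left _ _).trans (le_max_left _ _)
  · exact (le_max_right _ _).trans (le_max_left _ _)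

theorem measurable_stepPath {T t : ℝ} (ht : t < T) : Measurable (stepPath ht) :=
  (continuous_stepPath ht).measurable

theorem CadlagPath.eq_of_eqOn_dense {T : ℝ} {D : Set (Icc (0 : ℝ) T)} (hD : Dense D)
    {ω ω' : CadlagPath T} (h : ∀ s ∈ D, ω.toFun s = ω'.toFun s)
    (hT : ∀ s : Icc (0 : ℝ) T, (s : ℝ) = T → ω.toFun s = ω'.toFun s) : ω = ω' := by
  have key : ω.toFun = ω'.toFun := by
    ext s
    rcases eq_or_lt_of_le s.2.2 with hs | hs
    · exact hT s hs
    have hne : (Ioi s).Nonempty := ⟨⟨T, s.2.1.trans hs.le, le_rfl⟩, hs⟩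
    have hcl : s ∈ closure (Ioi s ∩ D) := by
      have h1 : closure (Ioi s) ⊆ closure (Ioi s ∩ D) :=
        closure_minimal (hD.open_subset_closure_inter isOpen_Ioi) isClosed_closure
      refine h1 ?_
      rw [closure_Ioi' hne]
      exact self_mem_Ici
    have : (𝓝[Ioi s ∩ D] s).NeBot := mem_closure_iff_nhdsWithin_neBot.1 hcl
    have hsub : Ioi s ∩ D ⊆ Ici s := fun u hu => mem_Ici.2 (mem_Ioi.1 hu.1).le
    refine tendsto_nhds_unique ((ω.right_cont s).mono hsub) ?_
    refine ((ω'.right_cont s).mono hsub).tendsto.congr' ?_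
    filter_upwards [self_mem_nhdsWithin] with u hu
    exact (h u hu.2).symm
  cases ω
  cases ω'
  congr

/-- An embedding allows a change of variables for integrands not known to be measurable, such as `f
(A.average ω)`. The values at `0`, `t`, `T` invert the map. Its range is measurable because, by
right continuity, being a step path is decided on a countable dense set of times; agreement at `T`
is automatic. -/
theorem measurableEmbedding_stepPath {T t : ℝ} [hT : Fact (0 < T)] (h0 : 0 < t) (ht : t < T) :
    MeasurableEmbedding (stepPath ht) := by
  let τ : Icc (0 : ℝ) T := ⟨t, h0.le, ht.le⟩
  let e : CadlagPath T → (ℝ × ℝ) × ℝ := fun ω => ((X (time0 T) ω, X τ ω), X (timeT T) ω)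
  have he : Measurable e := ((measurable_X _).prodMk (measurable_X _)).prodMk (measurable_X _)
  have hinv : Function.LeftInverse e (stepPath ht) := fun p => by
    have h1 := congrFun (X_stepPath_of_lt ht (s := time0 T) h0) p
    have h2 := congrFun (X_stepPath_of_le ht (s := τ) le_rfl ht) p
    have h3 := congrFun (X_stepPath_of_eq ht (s := timeT T) rfl) p
    exact Prod.ext (Prod.ext h1 h2) h3
  obtain ⟨D, hDc, hD⟩ := TopologicalSpace.exists_countable_dense (Icc (0 : ℝ) T)
  have hrange : range (stepPath ht) =
      ⋂ s ∈ D, {ω | X s (stepPath ht (e ω)) = X s ω} := by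
    ext ω
    simp only [mem_iInter, mem_ofPred_eq]
    constructor
    · rintro ⟨p, rfl⟩ s -
      rw [hinv p]
    · intro h
      refine ⟨e ω, CadlagPath.eq_of_eqOn_dense hD h fun s hs => ?_⟩
      refine (congrFun (X_stepPath_of_eq ht hs) (e ω)).trans ?_
      have : s = timeT T := Subtype.ext hs
      rw [this]
      rfl
  refine MeasurableEmbedding.of_measurable_inverse (measurable_stepPath ht) ?_ he hinv
  rw [hrange]
  exact MeasurableSet.biInter hDc fun s _ => measurableSet_eq_fun
    ((measurable_X s).comp ((measurable_stepPath ht).comp he)) (measurable_X s)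

theorem canonicalFiltration_apply {T : ℝ} (s : Icc (0 : ℝ) T) :
    canonicalFiltration T s = ⨆ j, ⨆ (_ : j ≤ s), MeasurableSpace.comap (X j) inferInstance := rfl

theorem IsThreeStepLaw.isMartingaleCoupling {T t : ℝ} [hT : Fact (0 < T)] (h0 : 0 < t) (ht : t < T)
    {μ θ ν : Measure ℝ} {Q : Measure ((ℝ × ℝ) × ℝ)} (hQ : IsThreeStepLaw μ θ ν Q) :
    IsMartingaleCoupling μ ν (Q.map (stepPath ht)) := by
  have := hQ.finite
  have hm := measurable_stepPath ht
  have hint : ∀ s, Integrable (X s ∘ stepPath ht) Q := fun s => by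
    rcases eq_or_lt_of_le s.2.2 with h | h
    · rw [X_stepPath_of_eq ht h]; exact hQ.integrable_third
    rcases lt_or_ge (s : ℝ) t with h' | h'
    · rw [X_stepPath_of_lt ht h']; exact hQ.integrable_first
    · rw [X_stepPath_of_le ht h' h]; exact hQ.integrable_second
  have hintX : ∀ s, Integrable (X s) (Q.map (stepPath ht)) := fun s =>
    (integrable_map_measure (measurable_X s).aestronglyMeasurable hm.aemeasurable).2 (hint s)
  have hset : ∀ (s : Icc (0 : ℝ) T) (B : Set (CadlagPath T)), MeasurableSet B →
      ∫ ω in B, X s ω ∂(Q.map (stepPath ht)) =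
        ∫ p in stepPath ht ⁻¹' B, (X s ∘ stepPath ht) p ∂Q := fun s B hB =>
    setIntegral_map hB (measurable_X s).aestronglyMeasurable hm.aemeasurable
  -- Pulled back along `stepPath`, the past at time `i` lies in the σ-algebra of the first
  -- coordinate if `i < t`, and of the first two if `t ≤ i < T`. The martingale property thus
  -- reduces to the two steps of `Q`.
  have key : ∀ (i j : Icc (0 : ℝ) T), i ≤ j → ∀ B, MeasurableSet[canonicalFiltration T i] B →
      ∫ p in stepPath ht ⁻¹' B, (X i ∘ stepPath ht) p ∂Q =
        ∫ p in stepPath ht ⁻¹' B, (X j ∘ stepPath ht) p ∂Q := by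
    intro i j hij B hB
    have hij' : (i : ℝ) ≤ j := hij
    have hpre : MeasurableSet[(canonicalFiltration T i).comap (stepPath ht)] (stepPath ht ⁻¹' B) :=
      ⟨B, hB, rfl⟩
    have hcomap : (canonicalFiltration T i).comap (stepPath ht) =
        ⨆ u, ⨆ (_ : u ≤ i), MeasurableSpace.comap (X u ∘ stepPath ht) inferInstance := by
      rw [canonicalFiltration_apply]
      simp_rw [MeasurableSpace.comap_iSup, MeasurableSpace.comap_comp]
    rw [hcomap] at hpre
    rcases eq_or_lt_of_le i.2.2 with hi | hi
    · have : i = j := le_antisymm hij (Subtype.coe_le_coe.1 (j.2.2.trans_eq hi.symm))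
      rw [this]
    rcases lt_or_ge (i : ℝ) t with hi' | hi'
    · have hle : (⨆ u, ⨆ (_ : u ≤ i), MeasurableSpace.comap (X u ∘ stepPath ht) inferInstance) ≤
          MeasurableSpace.comap (fun p : (ℝ × ℝ) × ℝ => p.1.1) inferInstance :=
        iSup₂_le fun u hu => by
          rw [X_stepPath_of_lt ht (lt_of_le_of_lt (Subtype.coe_le_coe.2 hu) hi')]
      obtain ⟨C, hC, hCB⟩ := hle _ hpre
      rw [← hCB, X_stepPath_of_lt ht hi']
      rcases eq_or_lt_of_le j.2.2 with hj | hj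
      · rw [X_stepPath_of_eq ht hj]
        exact ((hQ.first_step C hC).symm.trans (hQ.second_step (Prod.fst ⁻¹' C)
          (measurable_fst hC)).symm)
      rcases lt_or_ge (j : ℝ) t with hj' | hj'
      · rw [X_stepPath_of_lt ht hj']
      · rw [X_stepPath_of_le ht hj' hj]
        exact (hQ.first_step C hC).symm
    · have hle : (⨆ u, ⨆ (_ : u ≤ i), MeasurableSpace.comap (X u ∘ stepPath ht) inferInstance) ≤
          MeasurableSpace.comap (fun p : (ℝ × ℝ) × ℝ => p.1) inferInstance :=
        iSup₂_le fun u hu => by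
          have hu' : (u : ℝ) < T := lt_of_le_of_lt (Subtype.coe_le_coe.2 hu) hi
          rw [← measurable_iff_comap_le]
          rcases lt_or_ge (u : ℝ) t with h | h
          · rw [X_stepPath_of_lt ht h]
            exact measurable_fst.comp (comap_measurable _)
          · rw [X_stepPath_of_le ht h hu']
            exact measurable_snd.comp (comap_measurable _)
      obtain ⟨C, hC, hCB⟩ := hle _ hpre
      rw [← hCB, X_stepPath_of_le ht hi' hi]
      rcases eq_or_lt_of_le j.2.2 with hj | hj
      · rw [X_stepPath_of_eq ht hj]
        exact (hQ.second_step C hC).symm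
      · rw [X_stepPath_of_le ht (hi'.trans hij') hj]
  have hadapt : StronglyAdapted (canonicalFiltration T) (X (T := T)) :=
    Filtration.stronglyAdapted_natural fun s => (measurable_X s).stronglyMeasurable
  refine ⟨inferInstance, ?_, ?_, hadapt, fun i j hij => ?_⟩
  · rw [Measure.map_map (measurable_X _) hm, X_stepPath_of_lt ht (s := time0 T) h0, hQ.map_first]
  · rw [Measure.map_map (measurable_X _) hm, X_stepPath_of_eq ht (s := timeT T) rfl, hQ.map_third]
  · refine (ae_eq_condExp_of_forall_setIntegral_eq ((canonicalFiltration T).le i) (hintX j)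
      (fun B _ _ => (hintX i).integrableOn) (fun B hB _ => ?_)
      (hadapt i).aestronglyMeasurable).symm
    have hB' := (canonicalFiltration T).le i B hB
    rw [hset i B hB', hset j B hB']
    exact key i j hij B hB

/-! ### Averages along step paths. -/

namespace AveragingProcess

variable {T : ℝ} [hT : Fact (0 < T)]

theorem stieltjes_of_neg (A : AveragingProcess T) (ω : CadlagPath T) {s : ℝ} (hs : s < 0) :
    A.stieltjes ω s = 0 := if_pos hs

theorem stieltjes_of_mem (A : AveragingProcess T) (ω : CadlagPath T) (s : Icc (0 : ℝ) T) :
    A.stieltjes ω s = A.toFun s ω := by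
  refine (if_neg (not_lt.2 s.2.1)).trans ?_
  rw [projIcc_of_mem hT.out.le s.2]

theorem leftLim_stieltjes_zero (A : AveragingProcess T) (ω : CadlagPath T) :
    Function.leftLim (A.stieltjes ω) 0 = 0 := by
  refine leftLim_eq_of_tendsto (tendsto_const_nhds.congr' ?_)
  filter_upwards [self_mem_nhdsWithin] with s hs
  exact (A.stieltjes_of_neg ω hs).symm

theorem IsInterior.leftLim_stieltjes_end {A : AveragingProcess T} (hA : A.IsInterior)
    (ω : CadlagPath T) : Function.leftLim (A.stieltjes ω) T = 1 := by
  refine leftLim_eq_of_tendsto ?_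
  have h1 := hA.2 ω
  rw [A.end_eq] at h1
  have h2 : Tendsto (projIcc 0 T hT.out.le) (𝓝[<] T) (𝓝[<] timeT T) := by
    refine tendsto_nhdsWithin_iff.2 ⟨?_, ?_⟩
    · have := (continuous_projIcc (h := hT.out.le)).tendsto T
      rw [projIcc_right] at this
      exact this.mono_left nhdsWithin_le_nhds
    · filter_upwards [Ioo_mem_nhdsLT hT.out] with s hs
      rw [projIcc_of_mem hT.out.le ⟨hs.1.le, hs.2.le⟩]
      exact hs.2
  refine (h1.comp h2).congr' ?_
  filter_upwards [Ioo_mem_nhdsLT hT.out] with s hs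
  exact (if_neg (not_lt.2 hs.1.le)).symm

theorem leftLim_stieltjes_nonneg (A : AveragingProcess T) (ω : CadlagPath T) {t : ℝ} (h0 : 0 < t) :
    0 ≤ Function.leftLim (A.stieltjes ω) t := by
  rw [← A.stieltjes_of_neg ω (neg_one_lt_zero)]
  exact (A.stieltjes ω).mono.le_leftLim (by linarith)

theorem leftLim_stieltjes_le (A : AveragingProcess T) (ω : CadlagPath T) (t : Icc (0 : ℝ) T) :
    Function.leftLim (A.stieltjes ω) t ≤ A.toFun t ω := by
  rw [← A.stieltjes_of_mem]
  exact (A.stieltjes ω).mono.leftLim_le le_rfl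

theorem le_one (A : AveragingProcess T) (t : Icc (0 : ℝ) T) (ω : CadlagPath T) :
    A.toFun t ω ≤ 1 := by
  rw [← A.end_eq ω]
  exact A.mono ω t.2.2

/-- The measure `dA` gives mass `A_{t-}` to `[0, t)`, where the path is `p.1.1`, mass `1 - A_{t-}`
to `[t, T)`, where it is `p.1.2`, and none to `{T}`. -/
theorem IsInterior.average_stepPath {A : AveragingProcess T} (hA : A.IsInterior) {t : ℝ}
    (h0 : 0 < t) (ht : t < T) (p : (ℝ × ℝ) × ℝ) :
    A.average (stepPath ht p) =
      Function.leftLim (A.stieltjes (stepPath ht p)) t * p.1.1 +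
        (1 - Function.leftLim (A.stieltjes (stepPath ht p)) t) * p.1.2 := by
  set ω := stepPath ht p with hω
  set F := A.stieltjes ω with hF
  set g : ℝ → ℝ := fun s => X (projIcc 0 T hT.out.le s) ω with hg
  have hFT : F T = 1 := (A.stieltjes_of_mem ω (timeT T)).trans (A.end_eq ω)
  have hl0 := A.leftLim_stieltjes_nonneg ω h0
  have hl1 : Function.leftLim F t ≤ 1 :=
    (A.leftLim_stieltjes_le ω ⟨t, h0.le, ht.le⟩).trans (A.le_one _ _)
  have hm1 : F.measure (Ico 0 t) = ENNReal.ofReal (Function.leftLim F t) := by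
    rw [F.measure_Ico, A.leftLim_stieltjes_zero, sub_zero]
  have hm2 : F.measure (Ico t T) = ENNReal.ofReal (1 - Function.leftLim F t) := by
    rw [F.measure_Ico, hA.leftLim_stieltjes_end]
  have hm3 : F.measure {T} = 0 := by
    rw [F.measure_singleton, hA.leftLim_stieltjes_end, hFT, sub_self, ENNReal.ofReal_zero]
  have hg1 : EqOn g (fun _ => p.1.1) (Ico 0 t) := fun s hs => by
    have hs' : s ∈ Icc 0 T := ⟨hs.1, (hs.2.trans ht).le⟩
    simp only [hg]
    rw [projIcc_of_mem hT.out.le hs']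
    exact congrFun (X_stepPath_of_lt ht (s := ⟨s, hs'⟩) hs.2) p
  have hg2 : EqOn g (fun _ => p.1.2) (Ico t T) := fun s hs => by
    have hs' : s ∈ Icc 0 T := ⟨h0.le.trans hs.1, hs.2.le⟩
    simp only [hg]
    rw [projIcc_of_mem hT.out.le hs']
    exact congrFun (X_stepPath_of_le ht (s := ⟨s, hs'⟩) hs.1 hs.2) p
  have hi1 : IntegrableOn g (Ico 0 t) F.measure :=
    (integrableOn_congr_fun hg1 measurableSet_Ico).2
      (integrableOn_const (by rw [hm1]; exact ENNReal.ofReal_ne_top))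
  have hi2 : IntegrableOn g (Ico t T) F.measure :=
    (integrableOn_congr_fun hg2 measurableSet_Ico).2
      (integrableOn_const (by rw [hm2]; exact ENNReal.ofReal_ne_top))
  have hae : Ico 0 T =ᵐ[F.measure] Icc 0 T := by
    rw [← Ico_union_right hT.out.le]
    exact (union_ae_eq_left_of_ae_eq_empty (ae_eq_empty.2 hm3)).symm
  have hunion : Ico 0 T = Ico 0 t ∪ Ico t T := (Ico_union_Ico_eq_Ico h0.le ht.le).symm
  change ∫ s in Icc 0 T, g s ∂F.measure = _
  rw [← setIntegral_congr_set hae, hunion, setIntegral_union (Ico_disjoint_Ico_same)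
    measurableSet_Ico hi1 hi2, setIntegral_congr_fun measurableSet_Ico hg1,
    setIntegral_congr_fun measurableSet_Ico hg2, setIntegral_const, setIntegral_const,
    measureReal_def, measureReal_def, hm1, hm2, ENNReal.toReal_ofReal hl0,
    ENNReal.toReal_ofReal (by linarith), smul_eq_mul, smul_eq_mul]

theorem measurable_stieltjes (A : AveragingProcess T) (s : ℝ) :
    Measurable fun ω => A.stieltjes ω s := by
  rcases lt_or_ge s 0 with h | h
  · simp only [A.stieltjes_of_neg _ h]
    exact measurable_const
  · have : (fun ω => A.stieltjes ω s) = A.toFun (projIcc 0 T hT.out.le s) := by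
      ext ω
      exact if_neg (not_lt.2 h)
    rw [this]
    exact (A.adapted _).mono ((canonicalFiltration T).le _) le_rfl

theorem measurable_leftLim_stieltjes (A : AveragingProcess T) (t : ℝ) :
    Measurable fun ω => Function.leftLim (A.stieltjes ω) t := by
  refine measurable_of_tendsto_metrizable
    (f := fun (n : ℕ) ω => A.stieltjes ω (t - 1 / ((n : ℝ) + 1)))
    (fun n => A.measurable_stieltjes _) (tendsto_pi_nhds.2 fun ω => ?_)
  refine ((A.stieltjes ω).mono.tendsto_leftLim t).comp (tendsto_nhdsWithin_iff.2 ⟨?_, ?_⟩)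
  · simpa using tendsto_const_nhds.sub (tendsto_one_div_add_atTop_nhds_zero_nat (𝕜 := ℝ))
  · refine Eventually.of_forall fun n => ?_
    have : (0 : ℝ) < 1 / ((n : ℝ) + 1) := by positivity
    exact sub_lt_self t this

/-- An adapted process depends only on the past of the path. -/
theorem congr_of_eqOn (A : AveragingProcess T) {s : Icc (0 : ℝ) T} {ω ω' : CadlagPath T}
    (h : ∀ u ≤ s, X u ω = X u ω') : A.toFun s ω = A.toFun s ω' := by
  -- The sets that do not separate `ω` from `ω'` form a σ-algebra. It contains the generators up to
  -- time `s`, hence the level set of `A_s` through `ω`.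
  let m : MeasurableSpace (CadlagPath T) :=
    { MeasurableSet' := fun B => ω ∈ B ↔ ω' ∈ B
      measurableSet_empty := Iff.rfl
      measurableSet_compl := fun B hB => not_congr hB
      measurableSet_iUnion := fun B hB => by simp only [mem_iUnion]; exact exists_congr hB }
  have hle : (canonicalFiltration T s : MeasurableSpace (CadlagPath T)) ≤ m := by
    rw [canonicalFiltration_apply]
    refine iSup₂_le fun u hu => ?_
    rintro _ ⟨C, -, rfl⟩
    change X u ω ∈ C ↔ X u ω' ∈ C
    rw [h u hu]
  have h1 : ω ∈ A.toFun s ⁻¹' {A.toFun s ω} ↔ ω' ∈ A.toFun s ⁻¹' {A.toFun s ω} :=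
    hle _ (A.adapted s (measurableSet_singleton _))
  exact (h1.1 rfl).symm

/-- Both paths are `p.1.1` before `t`, so `A` agrees along them at all times before `t`. The left
limit is essential, as `A_t` may react to the jump at `t`. -/
theorem leftLim_stieltjes_stepPath_le (A : AveragingProcess T) {t t' : ℝ} (h0 : 0 < t)
    (ht : t < T) (ht' : t' < T) (htt' : t ≤ t') (p : (ℝ × ℝ) × ℝ) :
    Function.leftLim (A.stieltjes (stepPath ht p)) t ≤ A.stieltjes (stepPath ht' p) t := by
  refine le_of_tendsto ((A.stieltjes (stepPath ht p)).mono.tendsto_leftLim t) ?_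
  filter_upwards [Ioo_mem_nhdsLT h0] with s hs
  let σ : Icc (0 : ℝ) T := ⟨s, hs.1.le, (hs.2.trans ht).le⟩
  have h1 : A.stieltjes (stepPath ht p) s = A.stieltjes (stepPath ht' p) s := by
    refine (A.stieltjes_of_mem _ σ).trans (Eq.trans ?_ (A.stieltjes_of_mem _ σ).symm)
    refine A.congr_of_eqOn fun u hu => ?_
    have hu' : (u : ℝ) < t := lt_of_le_of_lt (Subtype.coe_le_coe.2 hu) hs.2
    exact (congrFun (X_stepPath_of_lt ht hu') p).trans
      (congrFun (X_stepPath_of_lt ht' (hu'.trans_le htt')) p).symm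
  rw [h1]
  exact (A.stieltjes _).mono hs.2.le

/-- The paths vary with `n`, but each term is bounded by `A` at time `t n` along the single path
jumping at `t 0`. Right continuity at `0` and `A_0 = 0` conclude. -/
theorem IsInterior.tendsto_leftLim_stieltjes {A : AveragingProcess T} (hA : A.IsInterior)
    {t : ℕ → ℝ} (h0 : ∀ n, 0 < t n) (ht : ∀ n, t n < T) (hle : ∀ n, t n ≤ t 0)
    (hlim : Tendsto t atTop (𝓝 0)) (p : (ℝ × ℝ) × ℝ) :
    Tendsto (fun n => Function.leftLim (A.stieltjes (stepPath (ht n) p)) (t n)) atTop (𝓝 0) := by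
  refine squeeze_zero (fun n => A.leftLim_stieltjes_nonneg _ (h0 n))
    (fun n => A.leftLim_stieltjes_stepPath_le (h0 n) (ht n) (ht 0) (hle n) p) ?_
  have h1 : A.stieltjes (stepPath (ht 0) p) 0 = 0 :=
    (A.stieltjes_of_mem _ (time0 T)).trans (hA.1 _)
  have h2 := (A.stieltjes (stepPath (ht 0) p)).right_continuous 0
  rw [ContinuousWithinAt, h1] at h2
  exact h2.comp (tendsto_nhdsWithin_iff.2 ⟨hlim, Eventually.of_forall fun n => (h0 n).le⟩)

end AveragingProcess

/-! ### Transfer of integrals and the basic lower bound for the price. -/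

theorem extIntegral_map_of_measurableEmbedding {α β : Type*} [MeasurableSpace α]
    [MeasurableSpace β] {e : α → β} (he : MeasurableEmbedding e) (m : Measure α) (g : β → EReal) :
    extIntegral (m.map e) g = extIntegral m (g ∘ e) := by
  simp only [extIntegral, he.lintegral_map, Function.comp_apply]

theorem extIntegral_map {α β : Type*} [MeasurableSpace α] [MeasurableSpace β] {e : α → β}
    (he : Measurable e) (m : Measure α) {g : β → EReal} (hg : Measurable g) :
    extIntegral (m.map e) g = extIntegral m (g ∘ e) := by
  simp only [extIntegral]
  have hneg : Measurable fun x => (-g x).toENNReal := hg.neg.ereal_toENNReal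
  rw [lintegral_map hg.ereal_toENNReal he, lintegral_map hneg he]
  rfl

theorem IsThreeStepLaw.le_robustPrice {T t : ℝ} [hT : Fact (0 < T)] (h0 : 0 < t) (ht : t < T)
    {μ θ ν : Measure ℝ} {Q : Measure ((ℝ × ℝ) × ℝ)} (hQ : IsThreeStepLaw μ θ ν Q)
    {𝒜 : Set (AveragingProcess T)} {A : AveragingProcess T} (hA : A ∈ 𝒜) (hAi : A.IsInterior)
    (f : ℝ → EReal) :
    extIntegral Q (fun p => f (Function.leftLim (A.stieltjes (stepPath ht p)) t * p.1.1 +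
        (1 - Function.leftLim (A.stieltjes (stepPath ht p)) t) * p.1.2)) ≤
      robustPrice μ ν f 𝒜 := by
  have h1 : extIntegral (Q.map (stepPath ht)) (fun ω => f (A.average ω)) ≤ robustPrice μ ν f 𝒜 :=
    le_iSup_of_le (Q.map (stepPath ht)) (le_iSup_of_le (hQ.isMartingaleCoupling h0 ht)
      (le_iSup₂_of_le A hA le_rfl))
  rw [extIntegral_map_of_measurableEmbedding (measurableEmbedding_stepPath h0 ht)] at h1
  refine (le_of_eq ?_).trans h1
  congr 1
  ext p
  exact congrArg f (hAi.average_stepPath h0 ht p).symm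

/-! ### Convex functions with values in `[0, ∞]` and Jensen's inequality. -/

/-- Convexity of a function on the line with values in `[0, ∞]`. -/
def ConvexENN (ψ : ℝ → ℝ≥0∞) : Prop :=
  ∀ ⦃x y : ℝ⦄ ⦃r s : ℝ⦄ ⦃a b : ℝ⦄, 0 ≤ r → 0 ≤ s → 0 ≤ a → 0 ≤ b → a + b = 1 →
    ψ x ≤ ENNReal.ofReal r → ψ y ≤ ENNReal.ofReal s →
      ψ (a * x + b * y) ≤ ENNReal.ofReal (a * r + b * s)

theorem ConvexENN.convexOn_toReal {ψ : ℝ → ℝ≥0∞} (h : ConvexENN ψ) :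
    ConvexOn ℝ {x | ψ x < ⊤} fun x => (ψ x).toReal := by
  have key : ∀ ⦃x⦄, ψ x < ⊤ → ∀ ⦃y⦄, ψ y < ⊤ → ∀ ⦃a b : ℝ⦄, 0 ≤ a → 0 ≤ b → a + b = 1 →
      ψ (a * x + b * y) ≤ ENNReal.ofReal (a * (ψ x).toReal + b * (ψ y).toReal) :=
    fun x hx y hy a b ha hb hab => h ENNReal.toReal_nonneg ENNReal.toReal_nonneg ha hb hab
      (ENNReal.ofReal_toReal hx.ne).ge (ENNReal.ofReal_toReal hy.ne).ge
  refine ⟨fun x hx y hy a b ha hb hab => (key hx hy ha hb hab).trans_lt ENNReal.ofReal_lt_top,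
    fun x hx y hy a b ha hb hab => ?_⟩
  simp only [smul_eq_mul]
  have h1 := ENNReal.toReal_mono ENNReal.ofReal_ne_top (key hx hy ha hb hab)
  rwa [ENNReal.toReal_ofReal (by positivity)] at h1

theorem ConvexENN.le_add {ψ : ℝ → ℝ≥0∞} (h : ConvexENN ψ) (x y : ℝ) {l : ℝ} (h0 : 0 ≤ l)
    (h1 : l ≤ 1) : ψ (l * x + (1 - l) * y) ≤ ψ x + ψ y := by
  by_cases hx : ψ x = ⊤
  · simp [hx]
  by_cases hy : ψ y = ⊤
  · simp [hy]
  have h2 : (0 : ℝ) ≤ (ψ x).toReal := ENNReal.toReal_nonneg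
  have h3 : (0 : ℝ) ≤ (ψ y).toReal := ENNReal.toReal_nonneg
  refine (h h2 h3 h0 (sub_nonneg.2 h1) (by ring) (ENNReal.ofReal_toReal hx).ge
    (ENNReal.ofReal_toReal hy).ge).trans ?_
  rw [← ENNReal.ofReal_toReal hx, ← ENNReal.ofReal_toReal hy, ← ENNReal.ofReal_add h2 h3,
    ENNReal.toReal_ofReal h2, ENNReal.toReal_ofReal h3]
  refine ENNReal.ofReal_le_ofReal ?_
  nlinarith

theorem ofReal_integral_le_lintegral_ofReal {α : Type*} [MeasurableSpace α] {m : Measure α}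
    {g : α → ℝ} (hg : Integrable g m) :
    ENNReal.ofReal (∫ x, g x ∂m) ≤ ∫⁻ x, ENNReal.ofReal (g x) ∂m := by
  have h1 : ∫ x, g x ∂m ≤ ∫ x, max (g x) 0 ∂m :=
    integral_mono hg hg.pos_part fun x => le_max_left _ _
  refine (ENNReal.ofReal_le_ofReal h1).trans_eq ?_
  rw [ofReal_integral_eq_lintegral_ofReal hg.pos_part (ae_of_all _ fun x => le_max_right _ _)]
  refine lintegral_congr fun x => ?_
  rcases le_total (g x) 0 with h | h
  · rw [max_eq_right h, ENNReal.ofReal_zero, ENNReal.ofReal_of_nonpos h]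
  · rw [max_eq_left h]

/-- Jensen's inequality for convex functions with values in `[0, ∞]`. -/
theorem ConvexENN.map_integral_le {ψ : ℝ → ℝ≥0∞} (h : ConvexENN ψ) (hψ : Measurable ψ)
    {p : Measure ℝ} [IsProbabilityMeasure p] (hp : Integrable (fun y : ℝ => y) p) :
    ψ (∫ y, y ∂p) ≤ ∫⁻ y, ψ y ∂p := by
  set c := ∫ y, y ∂p with hc
  by_cases htop : ∫⁻ y, ψ y ∂p = ⊤
  · rw [htop]; exact le_top
  have hfin : ∀ᵐ y ∂p, ψ y < ⊤ := ae_lt_top hψ htop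
  have hzero : ∫ y, (y - c) ∂p = 0 := by
    rw [integral_sub hp (integrable_const c), integral_const, probReal_univ, one_smul, ← hc,
      sub_self]
  have hi : Integrable (fun y => y - c) p := hp.sub (integrable_const c)
  -- No semicontinuity of `ψ` is assumed, so the boundary of its finiteness domain needs care. If
  -- `p` is not a point mass, its mean `c` has points of finiteness on both sides, hence is interior
  -- to that domain and admits a supporting line.
  by_cases hconst : ∀ᵐ y ∂p, y = c
  · have h1 : ∫⁻ y, ψ y ∂p = ∫⁻ _, ψ c ∂p := lintegral_congr_ae (by
      filter_upwards [hconst] with y hy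
      rw [hy])
    rw [h1, lintegral_const, measure_univ, mul_one]
  have hleft : ∃ x, x < c ∧ ψ x < ⊤ := by
    by_contra! hno
    have hnn : ∀ᵐ y ∂p, 0 ≤ y - c := by
      filter_upwards [hfin] with y hy
      by_contra hlt
      exact absurd hy (not_lt.2 (hno y (by linarith)))
    refine hconst ?_
    filter_upwards [(integral_eq_zero_iff_of_nonneg_ae hnn hi).1 hzero] with y hy
    exact sub_eq_zero.1 hy
  have hright : ∃ x, c < x ∧ ψ x < ⊤ := by
    by_contra! hno
    have hnn : ∀ᵐ y ∂p, 0 ≤ -(y - c) := by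
      filter_upwards [hfin] with y hy
      by_contra hlt
      exact absurd hy (not_lt.2 (hno y (by linarith)))
    refine hconst ?_
    have hzero' : ∫ y, -(y - c) ∂p = 0 := by rw [integral_neg, hzero, neg_zero]
    filter_upwards [(integral_eq_zero_iff_of_nonneg_ae hnn hi.neg).1 hzero'] with y hy
    exact sub_eq_zero.1 (neg_eq_zero.1 hy)
  obtain ⟨x₁, hx₁, hf₁⟩ := hleft
  obtain ⟨x₂, hx₂, hf₂⟩ := hright
  have hD := h.convexOn_toReal
  have hsub : Icc x₁ x₂ ⊆ {x | ψ x < ⊤} := hD.1.ordConnected.out hf₁ hf₂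
  have hcint : c ∈ interior {x | ψ x < ⊤} :=
    mem_interior_iff_mem_nhds.2 (mem_of_superset (Icc_mem_nhds hx₁ hx₂) hsub)
  obtain ⟨a, ha⟩ := exists_subgradient hD hcint
  have hcfin : ψ c < ⊤ := hsub ⟨hx₁.le, hx₂.le⟩
  have hint : Integrable (fun y => (ψ c).toReal + a * (y - c)) p :=
    (integrable_const _).add (hi.const_mul a)
  have hval : ∫ y, ((ψ c).toReal + a * (y - c)) ∂p = (ψ c).toReal := by
    rw [integral_add (integrable_const _) (hi.const_mul a), integral_const_mul, hzero,
      integral_const, probReal_univ, one_smul, mul_zero, add_zero]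
  calc ψ c = ENNReal.ofReal (∫ y, ((ψ c).toReal + a * (y - c)) ∂p) := by
        rw [hval, ENNReal.ofReal_toReal hcfin.ne]
    _ ≤ ∫⁻ y, ENNReal.ofReal ((ψ c).toReal + a * (y - c)) ∂p :=
        ofReal_integral_le_lintegral_ofReal hint
    _ ≤ ∫⁻ y, ψ y ∂p := by
        refine lintegral_mono_ae ?_
        filter_upwards [hfin] with y hy
        exact (ENNReal.ofReal_le_ofReal (ha y hy)).trans_eq (ENNReal.ofReal_toReal hy.ne)

theorem ConvexENN.lintegral_le_bind {ψ : ℝ → ℝ≥0∞} (h : ConvexENN ψ) (hψ : Measurable ψ)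
    {μ : Measure ℝ} {κ : Kernel ℝ ℝ} (hκ : IsMartingaleKernel μ κ) :
    ∫⁻ x, ψ x ∂μ ≤ ∫⁻ y, ψ y ∂(μ.bind κ) := by
  have := hκ.markov
  rw [Measure.lintegral_bind κ.aemeasurable hψ.aemeasurable]
  refine lintegral_mono_ae ?_
  filter_upwards [hκ.integrable, hκ.mean] with x h1 h2
  have h3 := h.map_integral_le hψ h1
  rwa [h2] at h3

open Classical in
/-- The negative part of `φ` on `J`, extended by `∞` off `J`. -/
noncomputable def negPartOn (J : Set ℝ) (φ : ℝ → EReal) (x : ℝ) : ℝ≥0∞ :=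
  if x ∈ J then (-φ x).toENNReal else ⊤

/-- Translates the epigraph of `negPartOn` into the hypograph of `φ` over `J`, so that concavity
transfers without arithmetic at infinity. -/
theorem negPartOn_le_ofReal_iff {J : Set ℝ} {φ : ℝ → EReal} {x r : ℝ} (hr : 0 ≤ r) :
    negPartOn J φ x ≤ ENNReal.ofReal r ↔ x ∈ J ∧ ((-r : ℝ) : EReal) ≤ φ x := by
  unfold negPartOn
  split_ifs with hx
  · simp only [hx, true_and]
    rw [← EReal.coe_ennreal_le_coe_ennreal_iff, EReal.coe_toENNReal_eq_max, EReal.coe_ennreal_ofReal,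
      max_eq_left hr, max_le_iff, EReal.neg_le, EReal.coe_neg]
    exact and_iff_right (EReal.coe_nonneg.2 hr)
  · simp [hx]

theorem ConcaveOnExt.convexENN_negPartOn {J : Set ℝ} {φ : ℝ → EReal} (h : ConcaveOnExt J φ) :
    ConvexENN (negPartOn J φ) := by
  intro x y r s a b hr hs ha hb hab hx hy
  rw [negPartOn_le_ofReal_iff hr] at hx
  rw [negPartOn_le_ofReal_iff hs] at hy
  rw [negPartOn_le_ofReal_iff (by positivity)]
  have h1 := h (x := (x, -r)) hx (y := (y, -s)) hy ha hb hab
  have e : -(a * r + b * s) = a * -r + b * -s := by ring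
  rw [e]
  exact h1

theorem ConvexENN.measurable {ψ : ℝ → ℝ≥0∞} (h : ConvexENN ψ) : Measurable ψ := by
  refine measurable_of_Iic fun r => ?_
  by_cases hr : r = ⊤
  · simp [hr]
  have : Convex ℝ (ψ ⁻¹' Iic r) := by
    intro x hx y hy a b ha hb hab
    have h0 : (0 : ℝ) ≤ r.toReal := ENNReal.toReal_nonneg
    have h1 := h h0 h0 ha hb hab (hx.trans (ENNReal.ofReal_toReal hr).ge)
      (hy.trans (ENNReal.ofReal_toReal hr).ge)
    rw [← add_mul, hab, one_mul, ENNReal.ofReal_toReal hr] at h1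
    exact h1
  exact this.ordConnected.measurableSet

theorem toENNReal_neg_le_negPartOn {J : Set ℝ} {φ f : ℝ → EReal} (h : ∀ x ∈ J, φ x ≤ f x) (x : ℝ) :
    (-f x).toENNReal ≤ negPartOn J φ x := by
  unfold negPartOn
  split_ifs with hx
  · exact EReal.toENNReal_le_toENNReal (EReal.neg_le_neg_iff.2 (h x hx))
  · exact le_top

theorem toENNReal_neg_le_abs (e : EReal) : (-e).toENNReal ≤ e.abs := by
  induction e with
  | bot => simp
  | top => simp
  | coe r =>
    rw [← EReal.coe_neg, EReal.real_coe_toENNReal, EReal.abs_def]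
    exact ENNReal.ofReal_le_ofReal (neg_le_abs r)

theorem lintegral_negPartOn_lt_top {J : Set ℝ} {φ : ℝ → EReal} {ν : Measure ℝ} (hJ : ν Jᶜ = 0)
    (h : IntegrableOnExt J φ ν) : ∫⁻ x, negPartOn J φ x ∂ν < ⊤ := by
  have hmem : ∀ᵐ x ∂ν, x ∈ J := hJ
  have h2 := h.2
  rw [Measure.restrict_eq_self_of_ae_mem hmem] at h2
  refine (lintegral_mono_ae ?_).trans_lt h2
  filter_upwards [hmem] with x hx
  rw [negPartOn, if_pos hx]
  exact toENNReal_neg_le_abs _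

/-! ### Irreducibility: `ν` is carried by `J`. -/

theorem FiniteFirstMoment.integrable_abs_sub {μ : Measure ℝ} (hμ : FiniteFirstMoment μ) (x : ℝ) :
    Integrable (fun y => |x - y|) μ := by
  have := hμ.finite
  exact ((integrable_const x).sub hμ.moment).abs

/-- Outside of `I`, on the side away from `I`, the measure `ν` has no mass. -/
theorem IsIrreduciblePair.measure_side_eq_zero {μ ν : Measure ℝ} (h : IsIrreduciblePair μ ν)
    {x ε : ℝ} (hε : |ε| = 1) (hx : x ∉ domainI μ ν) (hI : ∀ y ∈ domainI μ ν, ε * (y - x) ≤ 0) :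
    ν {y | 0 < ε * (y - x)} = 0 := by
  have hord := h.convexOrder
  have := hord.left.finite
  have := hord.right.finite
  -- Affine integrals agree under `μ` and `ν`, so comparing potentials at `x` compares the integrals
  -- of this positive part. It vanishes under `μ`, which lives on `I`.
  have habs : ∀ y, max (ε * (y - x)) 0 = (|x - y| + (ε * y + -(ε * x))) / 2 := fun y => by
    have h1 : |ε * (y - x)| = |x - y| := by rw [abs_mul, hε, one_mul, abs_sub_comm]
    rw [← h1]
    rcases le_total (ε * (y - x)) 0 with h2 | h2
    · rw [max_eq_right h2, abs_of_nonpos h2]; ring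
    · rw [max_eq_left h2, abs_of_nonneg h2]; ring
  have hint : ∀ m : Measure ℝ, FiniteFirstMoment m →
      Integrable (fun y => max (ε * (y - x)) 0) m ∧
        ∫ y, max (ε * (y - x)) 0 ∂m = (∫ y, |x - y| ∂m + ∫ y, (ε * y + -(ε * x)) ∂m) / 2 := by
    intro m hm
    simp only [habs]
    refine ⟨((hm.integrable_abs_sub x).add (hm.integrable_affine _ _)).div_const 2, ?_⟩
    rw [integral_div, integral_add (hm.integrable_abs_sub x) (hm.integrable_affine _ _)]
  have hpot : ∫ y, |x - y| ∂ν ≤ ∫ y, |x - y| ∂μ := by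
    have h1 : potential ν x ≤ potential μ x := not_lt.1 hx
    rw [potential, potential, ← ofReal_integral_eq_lintegral_ofReal
      (hord.right.integrable_abs_sub x) (ae_of_all _ fun y => abs_nonneg _),
      ← ofReal_integral_eq_lintegral_ofReal
      (hord.left.integrable_abs_sub x) (ae_of_all _ fun y => abs_nonneg _)] at h1
    exact (ENNReal.ofReal_le_ofReal_iff (integral_nonneg fun y => abs_nonneg _)).1 h1
  have hIm : MeasurableSet (domainI μ ν) := h.connected.ordConnected.measurableSet
  have hμI : ∀ᵐ y ∂μ, y ∈ domainI μ ν := by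
    have h1 := measure_compl hIm (measure_ne_top μ _)
    rw [h.full, tsub_self] at h1
    exact h1
  have hμ0 : ∫ y, max (ε * (y - x)) 0 ∂μ = 0 := by
    refine integral_eq_zero_of_ae ?_
    filter_upwards [hμI] with y hy
    exact max_eq_right (hI y hy)
  have hν0 : ∫ y, max (ε * (y - x)) 0 ∂ν = 0 := by
    refine le_antisymm ?_ (integral_nonneg fun y => le_max_right _ _)
    rw [(hint μ hord.left).2] at hμ0
    rw [(hint ν hord.right).2, ← hord.integral_affine]
    linarith
  have h2 := (integral_eq_zero_iff_of_nonneg (fun y => le_max_right _ _) (hint ν hord.right).1).1 hν0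
  refine measure_mono_null (fun y hy => ?_) (ae_iff.1 h2)
  have hy' : 0 < ε * (y - x) := hy
  simp only [mem_ofPred_eq, Pi.zero_apply]
  rw [max_eq_left hy'.le]
  exact hy'.ne'

theorem measure_Ioi_eq_zero_of_forall_gt {ν : Measure ℝ} {r : ℝ} (h : ∀ x, r < x → ν (Ioi x) = 0) :
    ν (Ioi r) = 0 := by
  obtain ⟨u, -, hu, hlim⟩ := exists_seq_strictAnti_tendsto r
  refine measure_mono_null (fun y hy => ?_) (measure_iUnion_null fun n => h (u n) (hu n))
  obtain ⟨n, hn⟩ := (hlim.eventually_lt_const (mem_Ioi.1 hy)).exists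
  exact mem_iUnion.2 ⟨n, hn⟩

theorem measure_Iio_eq_zero_of_forall_lt {ν : Measure ℝ} {r : ℝ} (h : ∀ x, x < r → ν (Iio x) = 0) :
    ν (Iio r) = 0 := by
  obtain ⟨u, -, hu, hlim⟩ := exists_seq_strictMono_tendsto r
  refine measure_mono_null (fun y hy => ?_) (measure_iUnion_null fun n => h (u n) (hu n))
  obtain ⟨n, hn⟩ := (hlim.eventually_const_lt (mem_Iio.1 hy)).exists
  exact mem_iUnion.2 ⟨n, hn⟩

theorem IsIrreduciblePair.measure_compl_domainJ {μ ν : Measure ℝ} (h : IsIrreduciblePair μ ν) :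
    ν (domainJ μ ν)ᶜ = 0 := by
  -- If `I` is empty then `μ` has mass zero, and so has `ν`.
  rcases (domainI μ ν).eq_empty_or_nonempty with hemp | ⟨i, hi⟩
  · have h1 := h.full
    rw [hemp, measure_empty, h.convexOrder.measure_univ_eq] at h1
    exact measure_mono_null (subset_univ _) h1.symm
  have hoc := h.connected.ordConnected
  have hatom : ∀ b, (IsGLB (domainI μ ν) b ∨ IsLUB (domainI μ ν) b) →
      ν ({b} ∩ (domainJ μ ν)ᶜ) = 0 := by
    intro b hb
    by_cases hb0 : ν {b} = 0
    · exact measure_mono_null inter_subset_left hb0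
    · have hbJ : b ∈ domainJ μ ν := Or.inr ⟨hb, hb0⟩
      rw [singleton_inter_eq_empty.2 (not_not.2 hbJ), measure_empty]
  have hI : ∀ x ∉ domainJ μ ν, x ∉ domainI μ ν := fun x hx hxI => hx (Or.inl hxI)
  have hub : ∀ x, i < x → x ∉ domainI μ ν → x ∈ upperBounds (domainI μ ν) := by
    intro x hx hxI y hy
    by_contra hlt
    exact hxI (hoc.out hi hy ⟨hx.le, (not_le.1 hlt).le⟩)
  have hlb : ∀ x, x < i → x ∉ domainI μ ν → x ∈ lowerBounds (domainI μ ν) := by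
    intro x hx hxI y hy
    by_contra hlt
    exact hxI (hoc.out hy hi ⟨(not_le.1 hlt).le, hx.le⟩)
  have hright : ν (Ioi i ∩ (domainJ μ ν)ᶜ) = 0 := by
    by_cases hbd : BddAbove (domainI μ ν)
    · have hr := isLUB_csSup ⟨i, hi⟩ hbd
      set r := sSup (domainI μ ν)
      -- Points `x > r` lie outside `I`; letting `x` decrease to `r` avoids deciding whether `r`
      -- itself does.
      have hIoi : ν (Ioi r) = 0 := measure_Ioi_eq_zero_of_forall_gt fun x hx => by
        have hxI : x ∉ domainI μ ν := fun hxI => absurd (hr.1 hxI) (not_le.2 hx)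
        have h1 := h.measure_side_eq_zero (ε := 1) (by simp) hxI
          fun y hy => by have := hr.1 hy; linarith
        simpa [Ioi] using h1
      refine measure_mono_null (fun y hy => ?_) (measure_union_null hIoi (hatom r (Or.inr hr)))
      rcases (hr.2 (hub y hy.1 (hI y hy.2))).lt_or_eq with h1 | h1
      · exact Or.inl h1
      · exact Or.inr ⟨h1.symm, hy.2⟩
    · have : Ioi i ∩ (domainJ μ ν)ᶜ = ∅ := eq_empty_of_forall_notMem fun y hy =>
        hbd ⟨y, hub y hy.1 (hI y hy.2)⟩
      rw [this, measure_empty]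
  have hleft : ν (Iio i ∩ (domainJ μ ν)ᶜ) = 0 := by
    by_cases hbd : BddBelow (domainI μ ν)
    · have hr := isGLB_csInf ⟨i, hi⟩ hbd
      set r := sInf (domainI μ ν)
      have hIio : ν (Iio r) = 0 := measure_Iio_eq_zero_of_forall_lt fun x hx => by
        have hxI : x ∉ domainI μ ν := fun hxI => absurd (hr.1 hxI) (not_le.2 hx)
        have h1 := h.measure_side_eq_zero (ε := -1) (by simp) hxI
          fun y hy => by have := hr.1 hy; linarith
        simpa [Iio] using h1
      refine measure_mono_null (fun y hy => ?_) (measure_union_null hIio (hatom r (Or.inl hr)))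
      rcases (hr.2 (hlb y hy.1 (hI y hy.2))).lt_or_eq with h1 | h1
      · exact Or.inl h1
      · exact Or.inr ⟨h1, hy.2⟩
    · have : Iio i ∩ (domainJ μ ν)ᶜ = ∅ := eq_empty_of_forall_notMem fun y hy =>
        hbd ⟨y, hlb y hy.1 (hI y hy.2)⟩
      rw [this, measure_empty]
  refine measure_mono_null (fun y hy => ?_) (measure_union_null hright hleft)
  rcases lt_trichotomy y i with h1 | rfl | h1
  · exact Or.inr ⟨h1, hy⟩
  · exact absurd hi (hI y hy)
  · exact Or.inl ⟨h1, hy⟩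

/-! ### Fatou's lemma for extended integrals. -/

/-- The nonnegative function `g + G`, written `g⁺ + (G - g⁻)` so that no `∞ - ∞` occurs in the
integrand; it brings Fatou's lemma back to `[0, ∞]`. -/
theorem coe_lintegral_add_eq_extIntegral_add {α : Type*} [MeasurableSpace α] {m : Measure α}
    {g : α → EReal} (hg : Measurable g) {G : α → ℝ≥0∞} (hfin : ∫⁻ x, G x ∂m ≠ ⊤)
    (hle : ∀ x, (-g x).toENNReal ≤ G x) :
    ((∫⁻ x, ((g x).toENNReal + (G x - (-g x).toENNReal)) ∂m : ℝ≥0∞) : EReal) =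
      extIntegral m g + ((∫⁻ x, G x ∂m : ℝ≥0∞) : EReal) := by
  have hneg : Measurable fun x => (-g x).toENNReal := hg.neg.ereal_toENNReal
  have hb : ∫⁻ x, (-g x).toENNReal ∂m ≤ ∫⁻ x, G x ∂m := lintegral_mono hle
  have hb' : ∫⁻ x, (-g x).toENNReal ∂m ≠ ⊤ := (hb.trans_lt hfin.lt_top).ne
  rw [lintegral_add_left hg.ereal_toENNReal, lintegral_sub hneg hb' (ae_of_all _ hle), extIntegral]
  generalize ∫⁻ x, (g x).toENNReal ∂m = a at *
  generalize ∫⁻ x, (-g x).toENNReal ∂m = b at *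
  generalize ∫⁻ x, G x ∂m = c at *
  lift b to ℝ≥0 using hb'
  lift c to ℝ≥0 using hfin
  rw [← ENNReal.coe_sub, EReal.coe_ennreal_add, sub_eq_add_neg, add_assoc]
  congr 1
  simp only [EReal.coe_nnreal_eq_coe_real]
  rw [← EReal.coe_neg, ← EReal.coe_add, NNReal.coe_sub (ENNReal.coe_le_coe.1 hb)]
  congr 1
  ring

/-- Fatou's lemma for extended-real functions whose negative parts have a common integrable
majorant. -/
theorem extIntegral_le_of_le_liminf {α : Type*} [MeasurableSpace α] {m : Measure α}
    {g : α → EReal} {gs : ℕ → α → EReal} {G : α → ℝ≥0∞} (hg : Measurable g)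
    (hgs : ∀ n, Measurable (gs n)) (hG : Measurable G) (hfin : ∫⁻ x, G x ∂m ≠ ⊤)
    (hle : ∀ x, (-g x).toENNReal ≤ G x) (hles : ∀ n x, (-gs n x).toENNReal ≤ G x)
    (hlim : ∀ x, g x ≤ liminf (fun n => gs n x) atTop) {S : EReal}
    (hS : ∀ n, extIntegral m (gs n) ≤ S) : extIntegral m g ≤ S := by
  set c : EReal := ((∫⁻ x, G x ∂m : ℝ≥0∞) : EReal) with hc
  have hn : ∀ n, ((∫⁻ x, ((gs n x).toENNReal + (G x - (-gs n x).toENNReal)) ∂m : ℝ≥0∞) : EReal) ≤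
      S + c := fun n => by
    rw [coe_lintegral_add_eq_extIntegral_add (hgs n) hfin (hles n)]
    exact add_le_add_left (hS n) c
  have hpos : 0 ≤ S + c := (EReal.coe_ennreal_nonneg _).trans (hn 0)
  have hn' : ∀ n, ∫⁻ x, ((gs n x).toENNReal + (G x - (-gs n x).toENNReal)) ∂m ≤
      (S + c).toENNReal := fun n => by
    rw [← EReal.coe_ennreal_le_coe_ennreal_iff, EReal.coe_toENNReal hpos]
    exact hn n
  have hpt : ∀ᵐ x ∂m, (g x).toENNReal + (G x - (-g x).toENNReal) ≤
      liminf (fun n => (gs n x).toENNReal + (G x - (-gs n x).toENNReal)) atTop := by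
    filter_upwards [ae_lt_top hG hfin] with x hx
    set H : EReal → ℝ≥0∞ := fun e => e.toENNReal + (G x - (-e).toENNReal) with hH
    have hmono : Monotone H := fun e e' hee => add_le_add (EReal.toENNReal_le_toENNReal hee)
      (tsub_le_tsub_left (EReal.toENNReal_le_toENNReal (EReal.neg_le_neg_iff.2 hee)) _)
    -- Finiteness of `G x` matters: `a ↦ ⊤ - a` is discontinuous at `⊤`.
    have hcont : Continuous H := by
      refine EReal.continuous_toENNReal.add ?_
      exact (ENNReal.continuous_sub_left hx.ne).comp
        (EReal.continuous_toENNReal.comp continuous_neg)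
    have h1 := hmono.map_liminf_of_continuousAt (F := atTop) (fun n => gs n x) hcont.continuousAt
    exact (hmono (hlim x)).trans h1.le
  have hfatou : ∫⁻ x, ((g x).toENNReal + (G x - (-g x).toENNReal)) ∂m ≤ (S + c).toENNReal := by
    refine (lintegral_mono_ae hpt).trans ((lintegral_liminf_le fun n => ?_).trans
      (liminf_le_of_frequently_le' (Frequently.of_forall hn')))
    have hneg : Measurable fun x => (-gs n x).toENNReal := (hgs n).neg.ereal_toENNReal
    exact (hgs n).ereal_toENNReal.add (hG.sub hneg)
  rw [← EReal.coe_ennreal_le_coe_ennreal_iff, EReal.coe_toENNReal hpos,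
    coe_lintegral_add_eq_extIntegral_add hg hfin hle, ← hc] at hfatou
  have hc' : c = (((∫⁻ x, G x ∂m).toReal : ℝ) : EReal) := (EReal.coe_ennreal_toReal hfin).symm
  rw [hc'] at hfatou
  have h2 := EReal.sub_le_of_le_add hfatou
  rwa [EReal.add_sub_cancel_right] at h2

/-! ### The two cases of the theorem. -/

theorem IsThreeStepLaw.extIntegral_second {μ θ ν : Measure ℝ} {Q : Measure ((ℝ × ℝ) × ℝ)}
    (hQ : IsThreeStepLaw μ θ ν Q) {f : ℝ → EReal} (hf : Measurable f) :
    extIntegral θ f = extIntegral Q fun p => f p.1.2 := by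
  rw [← hQ.map_second, extIntegral_map (by fun_prop) Q hf]
  rfl

theorem le_robustPrice_of_isStrictlyInterior {T : ℝ} [Fact (0 < T)] {μ θ ν : Measure ℝ}
    {Q : Measure ((ℝ × ℝ) × ℝ)} (hQ : IsThreeStepLaw μ θ ν Q) {𝒜 : Set (AveragingProcess T)}
    {A : AveragingProcess T} (hA : A ∈ 𝒜) (hAi : A.IsStrictlyInterior) {f : ℝ → EReal}
    (hf : Measurable f) : extIntegral θ f ≤ robustPrice μ ν f 𝒜 := by
  obtain ⟨hint, t, ht, hzero⟩ := hAi
  rw [hQ.extIntegral_second hf]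
  refine (le_of_eq ?_).trans (hQ.le_robustPrice ht.1 ht.2 hA hint f)
  congr 1
  ext p
  have h1 : Function.leftLim (A.stieltjes (stepPath ht.2 p)) t = 0 :=
    le_antisymm ((A.leftLim_stieltjes_le _ t).trans (hzero _).le)
      (A.leftLim_stieltjes_nonneg _ ht.1)
  rw [h1, zero_mul, zero_add, sub_zero, one_mul]

theorem le_robustPrice_of_isInterior {T : ℝ} [hT : Fact (0 < T)] {μ θ ν : Measure ℝ}
    {Q : Measure ((ℝ × ℝ) × ℝ)} (hQ : IsThreeStepLaw μ θ ν Q) {𝒜 : Set (AveragingProcess T)}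
    {A : AveragingProcess T} (hA : A ∈ 𝒜) (hAi : A.IsInterior) {f : ℝ → EReal}
    (hf : LowerSemicontinuous f) {ψ : ℝ → ℝ≥0∞} (hψ : ConvexENN ψ)
    (hfψ : ∀ x, (-f x).toENNReal ≤ ψ x) (hμ : ∫⁻ x, ψ x ∂μ ≠ ⊤) (hθ : ∫⁻ x, ψ x ∂θ ≠ ⊤) :
    extIntegral θ f ≤ robustPrice μ ν f 𝒜 := by
  have hT0 := hT.out
  have hfm : Measurable f := hf.measurable
  have hψm := hψ.measurable
  -- The shift by `2` keeps every `t n` strictly below `T`, including `t 0`, the latest jump time.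
  set t : ℕ → ℝ := fun n => T / ((n : ℝ) + 2) with ht_def
  have h0 : ∀ n, 0 < t n := fun n => by positivity
  have hlt : ∀ n, t n < T := fun n => by
    have : (0 : ℝ) ≤ n := by positivity
    exact div_lt_self hT0 (by linarith)
  have hle : ∀ n, t n ≤ t 0 := fun n => by
    refine div_le_div_of_nonneg_left hT0.le (by norm_num) ?_
    simp
  have hlim : Tendsto t atTop (𝓝 0) :=
    tendsto_const_nhds.div_atTop (tendsto_atTop_add_const_right _ _ tendsto_natCast_atTop_atTop)
  let l : ℕ → (ℝ × ℝ) × ℝ → ℝ := fun n p =>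
    Function.leftLim (A.stieltjes (stepPath (hlt n) p)) (t n)
  have hl0 : ∀ n p, 0 ≤ l n p := fun n p => A.leftLim_stieltjes_nonneg _ (h0 n)
  have hl1 : ∀ n p, l n p ≤ 1 := fun n p =>
    (A.leftLim_stieltjes_le _ ⟨t n, (h0 n).le, (hlt n).le⟩).trans (A.le_one _ _)
  have hlm : ∀ n, Measurable (l n) := fun n =>
    (A.measurable_leftLim_stieltjes (t n)).comp (measurable_stepPath (hlt n))
  let Z : ℕ → (ℝ × ℝ) × ℝ → ℝ := fun n p => l n p * p.1.1 + (1 - l n p) * p.1.2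
  have hZm : ∀ n, Measurable (Z n) := fun n =>
    ((hlm n).mul measurable_fst.fst).add
      ((measurable_const.sub (hlm n)).mul measurable_fst.snd)
  have hZlim : ∀ p, Tendsto (fun n => Z n p) atTop (𝓝 p.1.2) := fun p => by
    have h1 : Tendsto (fun n => l n p) atTop (𝓝 0) :=
      hAi.tendsto_leftLim_stieltjes h0 hlt hle hlim p
    have h2 := (h1.mul_const p.1.1).add ((h1.const_sub 1).mul_const p.1.2)
    simpa using h2
  have hψ1 : ∫⁻ p, ψ p.1.1 ∂Q = ∫⁻ x, ψ x ∂μ := by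
    rw [← hQ.map_first, lintegral_map hψm (by fun_prop)]
  have hψ2 : ∫⁻ p, ψ p.1.2 ∂Q = ∫⁻ x, ψ x ∂θ := by
    rw [← hQ.map_second, lintegral_map hψm (by fun_prop)]
  have hm1 : Measurable fun p : (ℝ × ℝ) × ℝ => ψ p.1.1 := hψm.comp measurable_fst.fst
  have hm2 : Measurable fun p : (ℝ × ℝ) × ℝ => ψ p.1.2 := hψm.comp measurable_fst.snd
  rw [hQ.extIntegral_second hfm]
  refine extIntegral_le_of_le_liminf (gs := fun n p => f (Z n p))
    (G := fun p => ψ p.1.1 + ψ p.1.2) (hfm.comp measurable_fst.snd) (fun n => hfm.comp (hZm n))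
    (hm1.add hm2) ?_ (fun p => (hfψ _).trans le_add_self)
    (fun n p => (hfψ _).trans (hψ.le_add _ _ (hl0 n p) (hl1 n p))) (fun p => ?_)
    fun n => hQ.le_robustPrice (h0 n) (hlt n) hA hAi f
  · rw [lintegral_add_left hm1, hψ1, hψ2]
    exact ENNReal.add_ne_top.2 ⟨hμ, hθ⟩
  · refine le_of_forall_lt fun c hc => ?_
    obtain ⟨d, hcd, hd⟩ := exists_between hc
    refine hcd.trans_le (le_liminf_of_le (by isBoundedDefault) ?_)
    filter_upwards [(hZlim p).eventually (hf p.1.2 d hd)] with n hn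
    exact hn.le

end RobustPricing

theorem mainTheorem4 (T : ℝ) [Fact (0 < T)] (μ ν : Measure ℝ)
    (hμν : RobustPricing.IsIrreduciblePair μ ν) (f : ℝ → EReal)
    (𝒜 : Set (RobustPricing.AveragingProcess T))
    (h : ((∃ A ∈ 𝒜, A.IsInterior) ∧ LowerSemicontinuous f ∧
            RobustPricing.BoundedBelowByConcave μ ν f) ∨
         ((∃ A ∈ 𝒜, A.IsStrictlyInterior) ∧ Measurable f)) :
    RobustPricing.auxPrimalValue μ ν f ≤ RobustPricing.robustPrice μ ν f 𝒜 := by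
  refine iSup_le fun θ => iSup_le fun hμθ => iSup_le fun hθν => ?_
  obtain ⟨κ₁, hκ₁, hb₁⟩ := hμθ.exists_martingaleKernel
  obtain ⟨κ₂, hκ₂, hb₂⟩ := hθν.exists_martingaleKernel
  obtain ⟨Q, hQ⟩ := RobustPricing.exists_threeStepLaw hμθ.left hμθ.right hθν.right hκ₁ hκ₂ hb₁ hb₂
  rcases h with ⟨⟨A, hA, hAi⟩, hf, φ, hconc, hint, hφf⟩ | ⟨⟨A, hA, hAi⟩, hf⟩
  · have hψ := hconc.convexENN_negPartOn
    have hν := RobustPricing.lintegral_negPartOn_lt_top hμν.measure_compl_domainJ hint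
    -- Jensen along `κ₂`, then along `κ₁`, carries the finiteness of `ν(ψ)` back to `θ` and `μ`.
    have hθ := hψ.lintegral_le_bind hψ.measurable hκ₂
    rw [hb₂] at hθ
    have hμ := hψ.lintegral_le_bind hψ.measurable hκ₁
    rw [hb₁] at hμ
    exact RobustPricing.le_robustPrice_of_isInterior hQ hA hAi hf hψ
      (RobustPricing.toENNReal_neg_le_negPartOn hφf) (hμ.trans_lt (hθ.trans_lt hν)).ne
      (hθ.trans_lt hν).ne
  · exact RobustPricing.le_robustPrice_of_isStrictlyInterior hQ hA hAi hf
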